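/- **Setting.** A Markov chain (MC) on a finite set $S$ is a pair $(s_I,P)$ with $s_I\in S$ and $P\colon S\times S\to[0,1]$, $\sum_tP(s,t)=1$ for all $s$; $\Pr^{\mathcal M}(s\leadsto G)$ is the probability, under the path measure started in $s$, that $G\subseteq S$ is eventually visited. An interval Markov chain (iMC) $\mathcal I=(S,s_I,\mathcal P)$ assigns to each $(s,t)\in S\times S$ an interval $\mathcal P(s,t)=[a,b]$ with $a\le b$ rational. $\mathrm{MC}(\mathcal I)$ is the set of MCs $(s_I,P)$ on $S$ with $P(s,t)\in\mathcal P(s,t)$ for all $s,t$. Fix $\mathrm{good}\subseteq S$ and let $\mathrm{bad}$ be the set of states $s$ with $\Pr^{\mathcal M}(s\leadsto\mathrm{good})=0$ for all $\mathcal M\in\mathrm{MC}(\mathcal I)$. The reachability interval $\langle\!\langle\mathcal I\rangle\!\rangle$ is $\big[\min_{\mathcal M\in \mathrm{MC}(\mathcal I)}\Pr^{\mathcal M}(s_I\leadsto\mathrm{good}),\ \max_{\mathcal M\in \mathrm{MC}(\mathcal I)}\Pr^{\mathcal M}(s_I\leadsto\mathrm{good})\big]$. For $\mathrm{opt}\in\{\min,\max\}$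 the system of equations of $\mathcal I$ in real unknowns $(x_s)_{s\in S}$ is: $x_s=1$ for $s\in\mathrm{good}$, $x_s=0$ for $s\in\mathrm{bad}$, and otherwise $$x_s=\mathrm{opt}\Big\{\sum_t a_tx_t \;\Big|\; a_t\in\mathcal P(s,t)\ (t\in S),\ \sum_ta_t=1\Big\}.$$ An end component (EC) is a nonempty set of states that is a bottom strongly connected component of some $\mathcal M\in\mathrm{MC}(\mathcal I)$; a MEC is an inclusion-maximal EC. Let $E$ be the set of MECs disjoint from $\mathrm{good}\cup\mathrm{bad}$. Put $\hat s=B$ if $s\in B\in E$, and $\hat s=\{s\}$ (identified with $s$) if $s$ lies in no member of $E$. For $A,B\subseteq S$ let $\mathcal P(A,B)=\sum_{s\in A,\,t\in B}\mathcal P(s,t)$ (sum of intervals). The EC elimination $\mathrm{elim}(\mathcal I)$ is the iMC with states $\{\hat s\mid s\in S\}$, initial state $\widehat{s_I}$, target set $\{\hat s\mid s\in\mathrm{good}\}$ (its bad states being defined from these as above) and transition intervals $$\hat{\mathcal P}(A,B)=\begin{cases}[0,1]&\text{if }A\in E,\ A\ne B\text{ and }\mathcal P(A,B)\neq[0,0],\\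 [0,1]&\text{if }A\in E\text{ and }B\cap\mathrm{bad}\ne\emptyset,\\ \mathcal P(A,B)&\text{if }A\notin E,\\ [0,0]&\text{otherwise.}\end{cases}$$ **Theorem.** Let $\mathcal I$ be an iMC and $\mathrm{good}\subseteq S$ such that 1. no interval $\mathcal P(s,t)$ contains a negative number, and $\mathrm{MC}(\mathcal I)\neq\emptyset$; 2. every EC that meets $\mathrm{good}$ is contained in $\mathrm{good}$ (e.g. the states of $\mathrm{good}$ are absorbing); 3. $\mathrm{bad}\neq\emptyset$, unless $E=\emptyset$; 4. transitions that leave an eliminated MEC can be taken: if $s\in B\in E$, $t\notin B$ and $\mathcal P(s,t)\ne[0,0]$, then some $\mathcal M=(s_I,P)\in\mathrm{MC}(\mathcal I)$ has $P(s,t)>0$. Then (a) for each $\mathrm{opt}\in\{\min,\max\}$ the system of equations of $\mathrm{elim}(\mathcal I)$ has exactly one solution, and (b) the minima and maxima that define $\langle\!\langle\mathcal I\rangle\!\rangle$ and $\langle\!\langle\mathrm{elim}(\mathcal I)\rangle\!\rangle$ exist, and $\langle\!\langle\mathcal I\rangle\!\rangle=\langle\!\langle\mathrm{elim}(\mathcal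 I)\rangle\!\rangle$. -/

import Mathlib

open MeasureTheory ProbabilityTheory

noncomputable section

/-- A Markov chain with finite state space `S`: an initial state and a row-stochastic matrix. -/
structure MarkovChain (S : Type*) [Fintype S] where
  init : S
  prob : S → S → ℝ
  prob_nonneg : ∀ s t, 0 ≤ prob s t
  prob_sum : ∀ s, ∑ t, prob s t = 1

namespace MarkovChain

variable {S : Type*} [Fintype S]

/-- The distribution of the direct successor of `s`. -/
def step (M : MarkovChain S) (s : S) : PMF S :=
  PMF.ofFintype (fun t => ENNReal.ofReal (M.prob s t)) (by
    rw [← ENNReal.ofReal_sum_of_nonneg (fun t _ => M.prob_nonneg s t), M.prob_sum s,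
      ENNReal.ofReal_one])

section Paths

variable [MeasurableSpace S] [DiscreteMeasurableSpace S]

/-- The transition function as a Markov kernel. -/
def stepKernel (M : MarkovChain S) : Kernel S S where
  toFun s := (M.step s).toMeasure
  measurable' := Measurable.of_discrete

instance (M : MarkovChain S) : IsMarkovKernel M.stepKernel :=
  ⟨fun s => inferInstanceAs (IsProbabilityMeasure (M.step s).toMeasure)⟩

/-- The next state given a finite history: it depends on the last state of the history only. -/
def historyKernel (M : MarkovChain S) (n : ℕ) : Kernel (Finset.Iic n → S) S :=
  M.stepKernel.comap (fun h => h ⟨n, Finset.mem_Iic.2 le_rfl⟩) (measurable_pi_apply _)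

instance (M : MarkovChain S) (n : ℕ) : IsMarkovKernel (M.historyKernel n) :=
  inferInstanceAs (IsMarkovKernel (M.stepKernel.comap _ _))

/-- The probability measure on infinite paths that start in `s`. -/
def pathMeasure (M : MarkovChain S) (s : S) : Measure (ℕ → S) :=
  Kernel.traj (X := fun _ => S) (fun n => M.historyKernel n) 0 (fun _ => s)

end Paths

/-- `Pr(s ⇝ good)`: the probability that an infinite path from `s` eventually visits `good`.
The finite state space carries the discrete σ-algebra. -/
def reachProb (M : MarkovChain S) (good : Set S) (s : S) : ℝ :=
  letI : MeasurableSpace S := ⊤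
  haveI : DiscreteMeasurableSpace S := ⟨fun _ => trivial⟩
  (M.pathMeasure s).real {ω | ∃ n, ω n ∈ good}

/-- `t` is reachable from `s` in the graph of `M` (in zero or more steps). -/
def Reachable (M : MarkovChain S) : S → S → Prop :=
  Relation.ReflTransGen (fun s t => 0 < M.prob s t)

/-- A bottom strongly connected component: a nonempty strongly connected set of states from which
no outside state is reachable. -/
def IsBSCC (M : MarkovChain S) (B : Finset S) : Prop :=
  B.Nonempty ∧ (∀ s ∈ B, ∀ t ∈ B, M.Reachable s t) ∧ ∀ s ∈ B, ∀ t, M.Reachable s t → t ∈ B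

end MarkovChain

/-- An interval Markov chain with finite state space `S`: the transition function maps `(s, t)` to
the closed interval `[lo s t, hi s t]` with rational end points. -/
structure IMC (S : Type*) where
  init : S
  lo : S → S → ℚ
  hi : S → S → ℚ
  lo_le_hi : ∀ s t, lo s t ≤ hi s t

/-- The two optimization directions. -/
inductive Opt
  | min
  | max

/-- `v = opt A`, where the optimum is attained. -/
def Opt.IsOptimum : Opt → Set ℝ → ℝ → Prop
  | .min, A, v => IsLeast A v
  | .max, A, v => IsGreatest A v

namespace IMC

variable {S : Type*} [Fintype S]

/-- The set of Markov chains induced by an interval Markov chain. -/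
def inducedMCs (I : IMC S) : Set (MarkovChain S) :=
  {M | M.init = I.init ∧ ∀ s t, (I.lo s t : ℝ) ≤ M.prob s t ∧ M.prob s t ≤ (I.hi s t : ℝ)}

/-- The states from which no induced Markov chain reaches `good` with positive probability. -/
def bad (I : IMC S) (good : Set S) : Set S :=
  {s | ∀ M ∈ I.inducedMCs, M.reachProb good s = 0}

/-- The reachability interval of `I` is `[a, b]`: the minimum and the maximum over the induced
Markov chains of the probability to reach `good` from the initial state exist, and they are
`a` and `b`. -/
def IsReachabilityInterval (I : IMC S) (good : Set S) (a b : ℝ) : Prop :=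
  IsLeast ((fun M => M.reachProb good I.init) '' I.inducedMCs) a ∧
    IsGreatest ((fun M => M.reachProb good I.init) '' I.inducedMCs) b

/-- `x` solves the Bellman system of equations of `I` for the optimization direction `opt`. -/
def SolvesSystem (I : IMC S) (good : Set S) (opt : Opt) (x : S → ℝ) : Prop :=
  (∀ s ∈ good, x s = 1) ∧
  (∀ s ∈ I.bad good, x s = 0) ∧
  ∀ s, s ∉ good → s ∉ I.bad good →
    opt.IsOptimum
      {v | ∃ a : S → ℝ, (∀ t, (I.lo s t : ℝ) ≤ a t ∧ a t ≤ (I.hi s t : ℝ)) ∧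
        ∑ t, a t = 1 ∧ v = ∑ t, a t * x t}
      (x s)

/-- An end component: a BSCC of some induced Markov chain. -/
def IsEC (I : IMC S) (B : Finset S) : Prop :=
  ∃ M ∈ I.inducedMCs, M.IsBSCC B

/-- The maximal end components that contain neither a state of `good` nor a state of `bad`. -/
def elimMECs (I : IMC S) (good : Set S) : Set (Finset S) :=
  {B | Maximal I.IsEC B ∧ ∀ s ∈ B, s ∉ good ∪ I.bad good}

open Classical in
/-- The state of the elimination that represents `s`: the eliminated maximal end component that
contains `s` if there is one (it is then unique), and `s` itself, as the set `{s}`, otherwise. -/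
def elimState (I : IMC S) (good : Set S) (s : S) : Finset S :=
  if h : ∃ B ∈ I.elimMECs good, s ∈ B then h.choose else {s}

open Classical in
/-- The state space of the elimination, i.e. the set of all `elimState s` with `s ∈ S`. -/
abbrev ElimStates (I : IMC S) (good : Set S) : Type _ :=
  {A : Finset S // A ∈ Finset.univ.image (I.elimState good)}

/-- `elimState` as a map into the state space of the elimination. -/
def toElim (I : IMC S) (good : Set S) (s : S) : I.ElimStates good :=
  ⟨I.elimState good s, by classical exact Finset.mem_image_of_mem _ (Finset.mem_univ s)⟩

/-- Lower end point of the interval of transitions from `A` into `B`, i.e. of the sum of the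
intervals of all transitions from a state of `A` to a state of `B`. -/
def setLo (I : IMC S) (A B : Finset S) : ℚ := ∑ s ∈ A, ∑ t ∈ B, I.lo s t

/-- Upper end point of the interval of transitions from `A` into `B`. -/
def setHi (I : IMC S) (A B : Finset S) : ℚ := ∑ s ∈ A, ∑ t ∈ B, I.hi s t

/-- The transition from the eliminated end component `A` to `B` gets the interval `[0, 1]`: either
`B` is another state and there is a transition from `A` into `B`, or `B` is a bad state. -/
def ElimEdge (I : IMC S) (good : Set S) (A B : Finset S) : Prop :=
  (A ≠ B ∧ ¬ (I.setLo A B = 0 ∧ I.setHi A B = 0)) ∨ ∃ t ∈ B, t ∈ I.bad good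

open Classical in
/-- The end component elimination of `I`. -/
def elim (I : IMC S) (good : Set S) : IMC (I.ElimStates good) where
  init := I.toElim good I.init
  lo A B := if A.1 ∈ I.elimMECs good then 0 else I.setLo A.1 B.1
  hi A B :=
    if A.1 ∈ I.elimMECs good then (if I.ElimEdge good A.1 B.1 then 1 else 0)
    else I.setHi A.1 B.1
  lo_le_hi A B := by
    split_ifs
    · exact zero_le_one
    · exact le_rfl
    · exact Finset.sum_le_sum fun s _ => Finset.sum_le_sum fun t _ => I.lo_le_hi s t

/-- The target states of the elimination. -/
def elimGood (I : IMC S) (good : Set S) : Set (I.ElimStates good) :=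
  I.toElim good '' good

end IMC

end

/-!
Reachability probabilities of a finite Markov chain are the least nonnegative solution of the
first-step equations (`MarkovChain.reachProb_eq_sum`, `MarkovChain.reachProb_le`). Lower bounds on
them come from a maximum principle (`MarkovChain.exists_isBSCC_pos`): if the difference `d` of a
candidate and the reachability probabilities is subharmonic wherever it is positive, then either
`d ≤ 0` or `d` is positive on a whole bottom component. So a fixed point `x` of the optimal choices
is the optimal value as soon as no relevant bottom component has positive values of `x` and avoids
the target (`IMC.isGreatest_reachProb`, `IMC.isLeast_reachProb`).

A chain of the elimination lifts to the original state space (`IMC.exists_lift`). At a state that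
is not eliminated, its row is split among the members of each class by interpolation between the
bounds. In an eliminated end component, the chain that makes it a bottom component is perturbed in
one row so that the component is left through one chosen transition, or it is kept if the choice is
to move to a bad state. A bottom component of the lifted chain that avoids target and bad states
lies in an eliminated end component, and must be one of those that are never left. Hence, in the
elimination, every bottom component of every chain meets a target or a bad state
(`IMC.elim_isBSCC_meets`). This makes the solution of the system of equations unique
(`IMC.SolvesSystem.unique`) and equal to the optimal probabilities; a solution exists by the
Knaster-Tarski theorem (`IMC.exists_solvesSystem`).

The same lift transfers values. The solution of the elimination, pulled back along
`s ↦ I.toElim good s`, is a fixed point for the lift of an optimal chain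
(`IMC.exists_chain_of_elim_solvesSystem`), because all transitions that an optimal row takes out of
an eliminated component have the optimal value. Conversely, all rows of the original chain are
compared with rows of the elimination: outside of eliminated components they induce such a row; in
an eliminated component they move along edges of the elimination or within the component, and the
minimum there is `0` because of the edge to a bad state.
-/

/-! ### Reachability probabilities as least fixed points -/

namespace MarkovChain

variable {S : Type*} [Fintype S]

open Classical in
/-- The probability to visit `good` within the first `n` steps, by recursion on the first step. -/
noncomputable def hitWithin (M : MarkovChain S) (good : Set S) : ℕ → S → ENNReal
  | 0, s => if s ∈ good then 1 else 0
  | n + 1, s => if s ∈ good then 1 else ∑ t, M.step s t * M.hitWithin good n t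

theorem hitWithin_of_mem (M : MarkovChain S) {good : Set S} {s : S} (hs : s ∈ good) (n : ℕ) :
    M.hitWithin good n s = 1 := by
  cases n <;> simp [hitWithin, hs]

theorem hitWithin_succ_of_notMem (M : MarkovChain S) {good : Set S} {s : S} (hs : s ∉ good)
    (n : ℕ) : M.hitWithin good (n + 1) s = ∑ t, M.step s t * M.hitWithin good n t := by
  simp [hitWithin, hs]

theorem hitWithin_le_succ (M : MarkovChain S) (good : Set S) (n : ℕ) (s : S) :
    M.hitWithin good n s ≤ M.hitWithin good (n + 1) s := by
  induction n generalizing s with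
  | zero => by_cases hs : s ∈ good <;> simp [hitWithin, hs]
  | succ n ih =>
    by_cases hs : s ∈ good
    · simp [M.hitWithin_of_mem hs]
    · rw [M.hitWithin_succ_of_notMem hs, M.hitWithin_succ_of_notMem hs]
      exact Finset.sum_le_sum fun t _ => mul_le_mul_right (ih t) _

theorem hitWithin_mono (M : MarkovChain S) (good : Set S) (s : S) :
    Monotone fun n => M.hitWithin good n s :=
  monotone_nat_of_le_succ fun n => M.hitWithin_le_succ good n s

theorem step_apply (M : MarkovChain S) (s t : S) : M.step s t = ENNReal.ofReal (M.prob s t) :=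
  rfl

theorem hitWithin_le_ofReal (M : MarkovChain S) {good : Set S} {x : S → ℝ} (hx : ∀ s, 0 ≤ x s)
    (hgood : ∀ s ∈ good, 1 ≤ x s) (hstep : ∀ s ∉ good, ∑ t, M.prob s t * x t ≤ x s) (n : ℕ)
    (s : S) : M.hitWithin good n s ≤ ENNReal.ofReal (x s) := by
  induction n generalizing s with
  | zero =>
    by_cases hs : s ∈ good
    · simpa [hitWithin, hs] using hgood s hs
    · simp [hitWithin, hs]
  | succ n ih =>
    by_cases hs : s ∈ good
    · rw [M.hitWithin_of_mem hs]
      simpa using hgood s hs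
    · rw [M.hitWithin_succ_of_notMem hs]
      calc ∑ t, M.step s t * M.hitWithin good n t
          ≤ ∑ t, ENNReal.ofReal (M.prob s t * x t) := by
            refine Finset.sum_le_sum fun t _ => ?_
            rw [step_apply, ENNReal.ofReal_mul (M.prob_nonneg s t)]
            exact mul_le_mul_right (ih t) _
        _ = ENNReal.ofReal (∑ t, M.prob s t * x t) :=
            (ENNReal.ofReal_sum_of_nonneg fun t _ => mul_nonneg (M.prob_nonneg s t) (hx t)).symm
        _ ≤ ENNReal.ofReal (x s) := ENNReal.ofReal_le_ofReal (hstep s hs)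

open Classical in
/-- The probability to visit `good` within the first `n + k` steps, given the history `y` of the
first `n` steps. -/
noncomputable def hitGiven (M : MarkovChain S) (good : Set S) (n k : ℕ)
    (y : Finset.Iic n → S) : ENNReal :=
  if ∃ i, y i ∈ good then 1 else M.hitWithin good k (y ⟨n, Finset.mem_Iic.2 le_rfl⟩)

theorem sum_step (M : MarkovChain S) (s : S) : ∑ t, M.step s t = 1 := by
  rw [← tsum_fintype (L := .unconditional S)]
  exact (M.step s).tsum_coe

theorem hitGiven_succ (M : MarkovChain S) (good : Set S) (n k : ℕ) (y : Finset.Iic n → S) :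
    ∑ t, M.step (y ⟨n, Finset.mem_Iic.2 le_rfl⟩) t * M.hitGiven good (n + 1) k
      (IicProdIoc (X := fun _ => S) n (n + 1) (y, fun _ => t)) =
    M.hitGiven good n (k + 1) y := by
  have hold : ∀ (t : S) (i : ℕ) (hi : i ≤ n),
      IicProdIoc (X := fun _ => S) n (n + 1) (y, fun _ => t)
        ⟨i, Finset.mem_Iic.2 (hi.trans n.le_succ)⟩ = y ⟨i, Finset.mem_Iic.2 hi⟩ :=
    fun t i hi => by simp [IicProdIoc, hi]
  have hnew : ∀ t : S, IicProdIoc (X := fun _ => S) n (n + 1) (y, fun _ => t)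
      ⟨n + 1, Finset.mem_Iic.2 le_rfl⟩ = t := fun t => by simp [IicProdIoc]
  by_cases hy : ∃ i, y i ∈ good
  · have hit : ∀ t : S, ∃ i, IicProdIoc (X := fun _ => S) n (n + 1) (y, fun _ => t) i ∈ good := by
      obtain ⟨⟨i, hi⟩, hyi⟩ := hy
      exact fun t => ⟨_, (hold t i (Finset.mem_Iic.1 hi)).symm ▸ hyi⟩
    simp [hitGiven, hy, hit, M.sum_step]
  · have hlast : y ⟨n, Finset.mem_Iic.2 le_rfl⟩ ∉ good := fun h => hy ⟨_, h⟩
    rw [hitGiven, if_neg hy, M.hitWithin_succ_of_notMem hlast]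
    refine Finset.sum_congr rfl fun t _ => ?_
    congr 1
    by_cases ht : t ∈ good
    · rw [M.hitWithin_of_mem ht, hitGiven, if_pos ⟨_, (hnew t).symm ▸ ht⟩]
    · rw [hitGiven, if_neg, hnew t]
      rintro ⟨⟨i, hi⟩, h⟩
      rcases (Finset.mem_Iic.1 hi).lt_or_eq with hlt | rfl
      · exact hy ⟨_, hold t i (Nat.lt_succ_iff.1 hlt) ▸ h⟩
      · exact ht (hnew t ▸ h)

section Paths

variable [MeasurableSpace S] [DiscreteMeasurableSpace S]

/-- One step of the Ionescu-Tulcea construction for the path measure of a finite chain. -/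
theorem lintegral_partialTraj_succ (M : MarkovChain S) (n : ℕ) (h : Finset.Iic 0 → S)
    (f : (Finset.Iic (n + 1) → S) → ENNReal) :
    ∫⁻ y, f y ∂(Kernel.partialTraj (X := fun _ => S) M.historyKernel 0 (n + 1) h) =
      ∫⁻ y, ∑ t, M.step (y ⟨n, Finset.mem_Iic.2 le_rfl⟩) t *
          f (IicProdIoc (X := fun _ => S) n (n + 1) (y, fun _ => t))
        ∂(Kernel.partialTraj (X := fun _ => S) M.historyKernel 0 n h) := by
  have hf : Measurable f := measurable_of_finite f
  have hconst : ∀ t : S, MeasurableEquiv.piSingleton (X := fun _ => S) n t = fun _ => t :=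
    fun t => funext fun i => by cases Nat.mem_Ioc_succ' i; rfl
  rw [Kernel.partialTraj_succ_eq_comp (Nat.zero_le n), Kernel.lintegral_comp _ _ _ hf]
  refine lintegral_congr fun y => ?_
  have := Kernel.IsMarkovKernel.map (M.historyKernel n)
    (MeasurableEquiv.piSingleton (X := fun _ => S) n).measurable
  rw [Kernel.partialTraj_succ_self, Kernel.lintegral_map _ (by fun_prop) _ hf]
  refine (Kernel.lintegral_id_prod (measurable_of_finite _) _ _).trans ?_
  rw [Kernel.lintegral_map _ (by fun_prop) _ (measurable_of_finite _)]
  rw [show (M.historyKernel n) y = (M.step (y ⟨n, Finset.mem_Iic.2 le_rfl⟩)).toMeasure from rfl,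
    lintegral_fintype]
  refine Finset.sum_congr rfl fun t _ => ?_
  rw [PMF.toMeasure_apply_singleton _ _ (measurableSet_singleton t), mul_comm,
    hconst]

theorem lintegral_hitGiven (M : MarkovChain S) (good : Set S) (s : S) (n k : ℕ) :
    ∫⁻ y, M.hitGiven good n k y
      ∂(Kernel.partialTraj (X := fun _ => S) M.historyKernel 0 n fun _ => s) =
    M.hitWithin good (n + k) s := by
  induction n generalizing k with
  | zero =>
    rw [Kernel.partialTraj_self, Kernel.id_apply, lintegral_dirac, hitGiven, Nat.zero_add]
    split_ifs with h
    · exact (M.hitWithin_of_mem h.choose_spec k).symm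
    · rfl
  | succ n ih =>
    rw [lintegral_partialTraj_succ]
    simp_rw [hitGiven_succ]
    rw [ih, Nat.add_right_comm, Nat.add_assoc]

theorem pathMeasure_hit_le (M : MarkovChain S) (good : Set S) (s : S) (n : ℕ) :
    M.pathMeasure s {ω | ∃ i ≤ n, ω i ∈ good} = M.hitWithin good n s := by
  have hmeas : MeasurableSet {y : Finset.Iic n → S | ∃ i, y i ∈ good} := Set.Finite.measurableSet
    (Set.toFinite _)
  have hpre : {ω : ℕ → S | ∃ i ≤ n, ω i ∈ good} =
      Preorder.frestrictLe (π := fun _ => S) n ⁻¹' {y | ∃ i, y i ∈ good} := by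
    ext ω
    simp [Preorder.frestrictLe]
  rw [hpre, pathMeasure, ← Measure.map_apply (by fun_prop) hmeas,
    ← Kernel.map_apply _ (by fun_prop), Kernel.traj_map_frestrictLe,
    ← lintegral_indicator_one hmeas]
  have := M.lintegral_hitGiven good s n 0
  rw [Nat.add_zero] at this
  rw [← this]
  refine lintegral_congr fun y => ?_
  by_cases hy : ∃ i, y i ∈ good
  · rw [hitGiven, if_pos hy]
    exact Set.indicator_of_mem (s := {y : Finset.Iic n → S | ∃ i, y i ∈ good}) hy _
  · rw [hitGiven, if_neg hy, hitWithin, if_neg fun h => hy ⟨_, h⟩]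
    exact Set.indicator_of_notMem (s := {y : Finset.Iic n → S | ∃ i, y i ∈ good}) hy _

theorem pathMeasure_hit (M : MarkovChain S) (good : Set S) (s : S) :
    M.pathMeasure s {ω | ∃ n, ω n ∈ good} = ⨆ n, M.hitWithin good n s := by
  have hunion : {ω : ℕ → S | ∃ n, ω n ∈ good} = ⋃ n, {ω | ∃ i ≤ n, ω i ∈ good} := by
    ext ω
    simp only [Set.mem_ofPred_eq, Set.mem_iUnion]
    exact ⟨fun ⟨n, h⟩ => ⟨n, n, le_rfl, h⟩, fun ⟨_, i, _, h⟩ => ⟨i, h⟩⟩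
  rw [hunion, Monotone.measure_iUnion]
  · exact iSup_congr fun n => M.pathMeasure_hit_le good s n
  · exact fun m n hmn ω ⟨i, hi, h⟩ => ⟨i, hi.trans hmn, h⟩

end Paths

theorem reachProb_eq_iSup (M : MarkovChain S) (good : Set S) (s : S) :
    M.reachProb good s = (⨆ n, M.hitWithin good n s).toReal := by
  let _ : MeasurableSpace S := ⊤
  have : DiscreteMeasurableSpace S := ⟨fun _ => trivial⟩
  rw [← M.pathMeasure_hit good s]
  rfl

theorem reachProb_nonneg (M : MarkovChain S) (good : Set S) (s : S) : 0 ≤ M.reachProb good s := by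
  rw [reachProb_eq_iSup]
  exact ENNReal.toReal_nonneg

theorem reachProb_of_mem (M : MarkovChain S) {good : Set S} {s : S} (hs : s ∈ good) :
    M.reachProb good s = 1 := by
  simp [reachProb_eq_iSup, M.hitWithin_of_mem hs]

/-- Reachability probabilities satisfy the first-step equation outside of the target. -/
theorem reachProb_eq_sum (M : MarkovChain S) {good : Set S} {s : S} (hs : s ∉ good) :
    M.reachProb good s = ∑ t, M.prob s t * M.reachProb good t := by
  have hfin : ∀ t, ⨆ n, M.hitWithin good n t ≠ ⊤ := by
    intro t
    refine ne_top_of_le_ne_top ENNReal.one_ne_top (iSup_le fun n => ?_)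
    simpa using M.hitWithin_le_ofReal (good := good) (x := fun _ => 1) (by simp) (by simp)
      (by simp [M.prob_sum]) n t
  have hstep : ⨆ n, M.hitWithin good n s = ∑ t, M.step s t * ⨆ n, M.hitWithin good n t := by
    rw [← (M.hitWithin_mono good s).iSup_nat_add 1]
    simp_rw [M.hitWithin_succ_of_notMem hs, ENNReal.mul_iSup]
    refine (ENNReal.finsetSum_iSup_of_monotone fun t m n hmn => ?_).symm
    exact mul_le_mul_right (M.hitWithin_mono good t hmn) _
  simp_rw [reachProb_eq_iSup]
  rw [hstep, ENNReal.toReal_sum]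
  · simp_rw [ENNReal.toReal_mul, step_apply, ENNReal.toReal_ofReal (M.prob_nonneg s _)]
  · exact fun t _ => ENNReal.mul_ne_top ENNReal.ofReal_ne_top (hfin t)

/-- Reachability probabilities are the least solution of the first-step equations: they lie below
every nonnegative supersolution. -/
theorem reachProb_le (M : MarkovChain S) {good : Set S} {x : S → ℝ} (hx : ∀ s, 0 ≤ x s)
    (hgood : ∀ s ∈ good, 1 ≤ x s) (hstep : ∀ s ∉ good, ∑ t, M.prob s t * x t ≤ x s) (s : S) :
    M.reachProb good s ≤ x s := by
  rw [reachProb_eq_iSup]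
  exact ENNReal.toReal_le_of_le_ofReal (hx s)
    (iSup_le fun n => M.hitWithin_le_ofReal hx hgood hstep n s)

end MarkovChain

/-! ### Bottom components and the maximum principle -/

namespace MarkovChain

variable {S : Type*} [Fintype S]

/-- No transition of positive probability leaves `T`. -/
def IsClosed (M : MarkovChain S) (T : Set S) : Prop :=
  ∀ s ∈ T, ∀ t, 0 < M.prob s t → t ∈ T

theorem IsClosed.reachable {M : MarkovChain S} {T : Set S} (hT : M.IsClosed T) {s t : S}
    (hs : s ∈ T) (h : M.Reachable s t) : t ∈ T := by
  induction h with
  | refl => exact hs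
  | tail _ h ih => exact hT _ ih _ h

/-- Reachability from a closed set depends on the transitions within this set only. -/
theorem Reachable.of_isClosed {M N : MarkovChain S} {T : Set S}
    (hT : M.IsClosed T) (hMN : ∀ s ∈ T, ∀ t, 0 < M.prob s t → 0 < N.prob s t) {s t : S}
    (hs : s ∈ T) (h : M.Reachable s t) : N.Reachable s t := by
  induction h with
  | refl => exact .refl
  | tail hsu hut ih => exact ih.tail (hMN _ (hT.reachable hs hsu) _ hut)

theorem IsBSCC.isClosed {M : MarkovChain S} {B : Finset S} (hB : M.IsBSCC B) :
    M.IsClosed (B : Set S) :=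
  fun s hs t h => hB.2.2 s hs t (Relation.ReflTransGen.single h)

theorem prob_eq_zero_of_not_pos (M : MarkovChain S) {s t : S} (h : ¬ 0 < M.prob s t) :
    M.prob s t = 0 :=
  le_antisymm (not_lt.1 h) (M.prob_nonneg s t)

theorem exists_prob_pos (M : MarkovChain S) (s : S) : ∃ t, 0 < M.prob s t := by
  by_contra! h
  have := M.prob_sum s
  rw [Finset.sum_eq_zero fun t _ => le_antisymm (h t) (M.prob_nonneg s t)] at this
  exact zero_ne_one this

theorem sum_prob_eq_one {M : MarkovChain S} {s : S} {B : Finset S}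
    (h : ∀ t, 0 < M.prob s t → t ∈ B) : ∑ t ∈ B, M.prob s t = 1 := by
  rw [← M.prob_sum s]
  exact Finset.sum_subset (Finset.subset_univ B) fun t _ ht =>
    M.prob_eq_zero_of_not_pos fun hp => ht (h t hp)

/-- Every nonempty closed set contains a bottom component: take a state of the set from which the
fewest states are reachable. -/
theorem IsClosed.exists_isBSCC {M : MarkovChain S} {T : Set S} (hT : M.IsClosed T)
    (hne : T.Nonempty) : ∃ B : Finset S, M.IsBSCC B ∧ ∀ s ∈ B, s ∈ T := by
  classical
  let R : S → Finset S := fun s => Finset.univ.filter fun t => M.Reachable s t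
  have hR : ∀ s t, t ∈ R s ↔ M.Reachable s t := fun s t => by simp [R]
  obtain ⟨s, hs, hmin⟩ := Set.exists_min_image T (fun s => (R s).card) (Set.toFinite _) hne
  refine ⟨R s, ⟨⟨s, (hR s s).2 .refl⟩, fun t ht u hu => ?_, fun t ht u hu => ?_⟩, fun t ht => ?_⟩
  · rw [hR] at ht hu
    have hsub : R t ⊆ R s := fun v hv => (hR s v).2 (ht.trans ((hR t v).1 hv))
    have heq := Finset.eq_of_subset_of_card_le hsub (hmin t (hT.reachable hs ht))
    exact (hR t u).1 (heq ▸ (hR s u).2 hu)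
  · exact (hR s u).2 (((hR s t).1 ht).trans hu)
  · exact hT.reachable hs ((hR s t).1 ht)

/-- The maximum principle: where a function that is subharmonic on its positivity set has a
positive maximum, it is constant along transitions, so that it is positive on a bottom
component. -/
theorem exists_isBSCC_pos (M : MarkovChain S) {d : S → ℝ}
    (hd : ∀ s, 0 < d s → d s ≤ ∑ t, M.prob s t * d t) (hpos : ∃ s, 0 < d s) :
    ∃ B : Finset S, M.IsBSCC B ∧ ∀ s ∈ B, 0 < d s := by
  obtain ⟨s₀, hs₀⟩ := hpos
  obtain ⟨m, -, hm⟩ := Finset.exists_max_image Finset.univ d ⟨s₀, Finset.mem_univ _⟩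
  have hle : ∀ s, d s ≤ d m := fun s => hm s (Finset.mem_univ s)
  have hdm : 0 < d m := hs₀.trans_le (hle s₀)
  have hT : M.IsClosed {s | d s = d m} := by
    intro s hs t hst
    by_contra hne
    have hlt : d t < d m := lt_of_le_of_ne (hle t) hne
    have hs' : d s = d m := hs
    have h1 := hd s (hs'.symm ▸ hdm)
    have h2 : ∑ t, M.prob s t * d t < ∑ t, M.prob s t * d m :=
      Finset.sum_lt_sum (fun u _ => mul_le_mul_of_nonneg_left (hle u) (M.prob_nonneg s u))
        ⟨t, Finset.mem_univ t, mul_lt_mul_of_pos_left hlt hst⟩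
    rw [← Finset.sum_mul, M.prob_sum, one_mul] at h2
    linarith
  obtain ⟨B, hB, hBT⟩ := hT.exists_isBSCC ⟨m, rfl⟩
  exact ⟨B, hB, fun s hs => (hBT s hs).symm ▸ hdm⟩

theorem reachProb_pos_of_reachable (M : MarkovChain S) {good : Set S} {s t : S} (ht : t ∈ good)
    (h : M.Reachable s t) : 0 < M.reachProb good s := by
  induction h using Relation.ReflTransGen.head_induction_on with
  | refl => rw [M.reachProb_of_mem ht]; exact one_pos
  | @head s u hsu _ ih =>
    by_cases hs : s ∈ good
    · rw [M.reachProb_of_mem hs]; exact one_pos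
    · rw [M.reachProb_eq_sum hs]
      exact Finset.sum_pos' (fun v _ => mul_nonneg (M.prob_nonneg s v) (M.reachProb_nonneg good v))
        ⟨u, Finset.mem_univ u, mul_pos hsu ih⟩

theorem reachProb_eq_zero_of_isClosed (M : MarkovChain S) {good T : Set S} (hT : M.IsClosed T)
    (hdisj : ∀ s ∈ T, s ∉ good) {s : S} (hs : s ∈ T) : M.reachProb good s = 0 := by
  classical
  refine le_antisymm ?_ (M.reachProb_nonneg good s)
  have h := M.reachProb_le (good := good) (x := fun s => if s ∈ T then 0 else 1)
    (fun s => by split_ifs <;> norm_num)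
    (fun s hs => by rw [if_neg fun h => hdisj s h hs])
    (fun s _ => by
      by_cases hsT : s ∈ T
      · rw [if_pos hsT]
        refine (Finset.sum_eq_zero fun t _ => ?_).le
        by_cases ht : t ∈ T
        · simp [ht]
        · rw [M.prob_eq_zero_of_not_pos fun h => ht (hT s hsT t h), zero_mul]
      · rw [if_neg hsT]
        refine (Finset.sum_le_sum fun t _ => ?_).trans (M.prob_sum s).le
        exact mul_le_of_le_one_right (M.prob_nonneg s t) (by split_ifs <;> norm_num)) s
  simpa [hs] using h

theorem reachProb_eq_zero_iff (M : MarkovChain S) {good : Set S} {s : S} :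
    M.reachProb good s = 0 ↔ ∀ t, M.Reachable s t → t ∉ good := by
  refine ⟨fun h t hst ht => (M.reachProb_pos_of_reachable ht hst).ne' h, fun h => ?_⟩
  exact M.reachProb_eq_zero_of_isClosed (T := {t | M.Reachable s t})
    (fun t ht u hu => Relation.ReflTransGen.tail ht hu) h .refl

end MarkovChain

/-! ### Admissible rows of an interval Markov chain -/

/-- Every value between the sums of lower and upper bounds is the sum of a vector within these
bounds. -/
theorem exists_bounded_sum_eq {ι : Type*} (B : Finset ι) {l u : ι → ℝ} (hlu : ∀ i, l i ≤ u i)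
    {v : ℝ} (hl : ∑ i ∈ B, l i ≤ v) (hu : v ≤ ∑ i ∈ B, u i) :
    ∃ a : ι → ℝ, (∀ i, l i ≤ a i ∧ a i ≤ u i) ∧ ∑ i ∈ B, a i = v := by
  rcases (hl.trans hu).eq_or_lt with heq | hlt
  · exact ⟨l, fun i => ⟨le_rfl, hlu i⟩, le_antisymm hl (heq ▸ hu)⟩
  · have hpos : 0 < ∑ i ∈ B, u i - ∑ i ∈ B, l i := sub_pos.2 hlt
    -- interpolate linearly between the bounds, with the same ratio for all entries
    let c := (v - ∑ i ∈ B, l i) / (∑ i ∈ B, u i - ∑ i ∈ B, l i)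
    have hc0 : 0 ≤ c := div_nonneg (sub_nonneg.2 hl) hpos.le
    have hc1 : c ≤ 1 := (div_le_one hpos).2 (by linarith)
    refine ⟨fun i => l i + c * (u i - l i), fun i => ⟨?_, ?_⟩, ?_⟩
    · nlinarith [hlu i]
    · nlinarith [hlu i]
    · rw [Finset.sum_add_distrib, ← Finset.mul_sum, Finset.sum_sub_distrib,
        div_mul_cancel₀ _ hpos.ne']
      ring

namespace IMC

variable {S : Type*} [Fintype S]

/-- The probability distributions that `I` admits for the successor of `s`. -/
def IsRow (I : IMC S) (s : S) (a : S → ℝ) : Prop :=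
  (∀ t, (I.lo s t : ℝ) ≤ a t ∧ a t ≤ (I.hi s t : ℝ)) ∧ ∑ t, a t = 1

/-- Some admissible distribution gives the transition from `s` to `t` a positive probability. -/
def CanStep (I : IMC S) (s t : S) : Prop :=
  ∃ a, I.IsRow s a ∧ 0 < a t

variable {I : IMC S}

theorem isRow_of_mem {M : MarkovChain S} (hM : M ∈ I.inducedMCs) (s : S) :
    I.IsRow s (M.prob s) :=
  ⟨hM.2 s, M.prob_sum s⟩

theorem canStep_of_mem {M : MarkovChain S} (hM : M ∈ I.inducedMCs) {s t : S}
    (h : 0 < M.prob s t) : I.CanStep s t :=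
  ⟨_, isRow_of_mem hM s, h⟩

theorem reflTransGen_of_mem {M : MarkovChain S} (hM : M ∈ I.inducedMCs) {s t : S}
    (h : M.Reachable s t) : Relation.ReflTransGen I.CanStep s t :=
  Relation.ReflTransGen.mono (fun _ _ h => canStep_of_mem hM h) _ _ h

theorem IsRow.nonneg (hnonneg : ∀ s t, 0 ≤ I.lo s t) {s : S} {a : S → ℝ} (ha : I.IsRow s a)
    (t : S) : 0 ≤ a t :=
  le_trans (by exact_mod_cast hnonneg s t) (ha.1 t).1

/-- The rows of an induced Markov chain can be chosen independently of each other. -/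
theorem exists_mem_of_rows (hnonneg : ∀ s t, 0 ≤ I.lo s t) {r : S → S → ℝ}
    (hr : ∀ s, I.IsRow s (r s)) : ∃ M ∈ I.inducedMCs, M.prob = r :=
  ⟨⟨I.init, r, fun s => (hr s).nonneg hnonneg, fun s => (hr s).2⟩, ⟨rfl, fun s => (hr s).1⟩, rfl⟩

/-- The mean of two admissible rows is admissible, and its support is the union of the supports. -/
theorem IsRow.exists_mean (hnonneg : ∀ s t, 0 ≤ I.lo s t) {s : S} {a b : S → ℝ}
    (ha : I.IsRow s a) (hb : I.IsRow s b) :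
    ∃ c, I.IsRow s c ∧ ∀ t, 0 < c t ↔ 0 < a t ∨ 0 < b t := by
  refine ⟨fun t => (a t + b t) / 2, ⟨fun t => ⟨?_, ?_⟩, ?_⟩, fun t => ⟨fun h => ?_, fun h => ?_⟩⟩
  · linarith [(ha.1 t).1, (hb.1 t).1]
  · linarith [(ha.1 t).2, (hb.1 t).2]
  · rw [← Finset.sum_div, Finset.sum_add_distrib, ha.2, hb.2]
    norm_num
  · by_contra! hn
    dsimp only at h
    linarith [hn.1, hn.2]
  · have := ha.nonneg hnonneg t
    have := hb.nonneg hnonneg t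
    rcases h with h | h <;> linarith

theorem exists_isRow_pos (hnonneg : ∀ s t, 0 ≤ I.lo s t) (hMC : I.inducedMCs.Nonempty) (s : S) :
    ∃ a, I.IsRow s a ∧ ∀ t, I.CanStep s t → 0 < a t := by
  classical
  suffices h : ∀ F : Finset S, ∃ a, I.IsRow s a ∧ ∀ t ∈ F, I.CanStep s t → 0 < a t by
    simpa using h Finset.univ
  intro F
  induction F using Finset.induction_on with
  | empty =>
    obtain ⟨M, hM⟩ := hMC
    exact ⟨_, isRow_of_mem hM s, by simp⟩
  | insert u F _ ih =>
    obtain ⟨a, ha, haF⟩ := ih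
    by_cases hu : I.CanStep s u
    · obtain ⟨b, hb, hbu⟩ := hu
      obtain ⟨c, hc, hpos⟩ := ha.exists_mean hnonneg hb
      refine ⟨c, hc, fun t ht hst => (hpos t).2 ?_⟩
      rcases Finset.mem_insert.1 ht with rfl | ht
      · exact .inr hbu
      · exact .inl (haF t ht hst)
    · refine ⟨a, ha, fun t ht hst => ?_⟩
      rcases Finset.mem_insert.1 ht with rfl | ht
      · exact absurd hst hu
      · exact haF t ht hst

/-- Some induced Markov chain takes all possible transitions. -/
theorem exists_mem_full (hnonneg : ∀ s t, 0 ≤ I.lo s t) (hMC : I.inducedMCs.Nonempty) :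
    ∃ M ∈ I.inducedMCs, ∀ s t, I.CanStep s t → 0 < M.prob s t := by
  choose r hr hpos using fun s => exists_isRow_pos hnonneg hMC s
  obtain ⟨M, hM, rfl⟩ := exists_mem_of_rows hnonneg hr
  exact ⟨M, hM, hpos⟩

/-- Bad states are those from which no target state is reachable in the graph of the interval
Markov chain. -/
theorem mem_bad_iff (hnonneg : ∀ s t, 0 ≤ I.lo s t) (hMC : I.inducedMCs.Nonempty) {good : Set S}
    {s : S} : s ∈ I.bad good ↔ ∀ t, Relation.ReflTransGen I.CanStep s t → t ∉ good := by
  constructor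
  · intro hs t hst
    obtain ⟨M, hM, hpos⟩ := exists_mem_full hnonneg hMC
    exact M.reachProb_eq_zero_iff.1 (hs M hM) t (Relation.ReflTransGen.mono hpos _ _ hst)
  · intro hs M hM
    exact M.reachProb_eq_zero_iff.2 fun t hst =>
      hs t (reflTransGen_of_mem hM hst)

theorem mem_bad_of_reflTransGen (hnonneg : ∀ s t, 0 ≤ I.lo s t) (hMC : I.inducedMCs.Nonempty)
    {good : Set S} {s t : S} (hs : s ∈ I.bad good) (hst : Relation.ReflTransGen I.CanStep s t) :
    t ∈ I.bad good :=
  (mem_bad_iff hnonneg hMC).2 fun u htu =>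
    (mem_bad_iff hnonneg hMC).1 hs u (hst.trans htu)

theorem mem_bad_of_canStep (hnonneg : ∀ s t, 0 ≤ I.lo s t) (hMC : I.inducedMCs.Nonempty)
    {good : Set S} {s t : S} (hs : s ∈ I.bad good) (hst : I.CanStep s t) : t ∈ I.bad good :=
  mem_bad_of_reflTransGen hnonneg hMC hs (.single hst)

theorem notMem_bad_of_mem_good (hMC : I.inducedMCs.Nonempty) {good : Set S} {s : S}
    (hs : s ∈ good) : s ∉ I.bad good := by
  obtain ⟨M, hM⟩ := hMC
  intro h
  have h := h M hM
  rw [M.reachProb_of_mem hs] at h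
  exact one_ne_zero h

/-! ### End components -/

open Classical in
/-- Overlapping end components have an end component as their union: states in the overlap take
the mean of the rows of the two Markov chains. -/
theorem IsEC.union (hnonneg : ∀ s t, 0 ≤ I.lo s t) {A B : Finset S} (hA : I.IsEC A)
    (hB : I.IsEC B) {s : S} (hsA : s ∈ A) (hsB : s ∈ B) : I.IsEC (A ∪ B) := by
  obtain ⟨M, hM, hMA⟩ := hA
  obtain ⟨N, hN, hNB⟩ := hB
  choose m hm hmpos using fun u => (isRow_of_mem hM u).exists_mean hnonneg (isRow_of_mem hN u)
  obtain ⟨L, hL, hLr⟩ := exists_mem_of_rows hnonneg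
    (r := fun u => if u ∈ A then if u ∈ B then m u else M.prob u else N.prob u)
    (fun u => by
      split_ifs
      exacts [hm u, isRow_of_mem hM u, isRow_of_mem hN u])
  have hML : ∀ u ∈ (A : Set S), ∀ v, 0 < M.prob u v → 0 < L.prob u v := by
    intro u hu v huv
    by_cases huB : u ∈ B
    · simp only [hLr, if_pos (Finset.mem_coe.1 hu), if_pos huB]
      exact (hmpos u v).2 (.inl huv)
    · simpa only [hLr, if_pos (Finset.mem_coe.1 hu), if_neg huB] using huv
  have hNL : ∀ u ∈ (B : Set S), ∀ v, 0 < N.prob u v → 0 < L.prob u v := by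
    intro u hu v huv
    by_cases huA : u ∈ A
    · simp only [hLr, if_pos (Finset.mem_coe.1 hu), if_pos huA]
      exact (hmpos u v).2 (.inr huv)
    · simpa only [hLr, if_neg huA] using huv
  have hclosed : L.IsClosed (↑(A ∪ B) : Set S) := by
    intro u hu v huv
    rw [Finset.mem_coe, Finset.mem_union] at hu ⊢
    by_cases huA : u ∈ A
    · by_cases huB : u ∈ B
      · simp only [hLr, if_pos huA, if_pos huB] at huv
        exact ((hmpos u v).1 huv).imp (hMA.isClosed u huA v) (hNB.isClosed u huB v)
      · simp only [hLr, if_pos huA, if_neg huB] at huv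
        exact .inl (hMA.isClosed u huA v huv)
    · simp only [hLr, if_neg huA] at huv
      exact .inr (hNB.isClosed u (hu.resolve_left huA) v huv)
  have hA' : ∀ u ∈ A, ∀ v ∈ A, L.Reachable u v := fun u hu v hv =>
    .of_isClosed hMA.isClosed hML hu (hMA.2.1 u hu v hv)
  have hB' : ∀ u ∈ B, ∀ v ∈ B, L.Reachable u v := fun u hu v hv =>
    .of_isClosed hNB.isClosed hNL hu (hNB.2.1 u hu v hv)
  refine ⟨L, hL, ⟨s, Finset.mem_union_left _ hsA⟩, fun u hu v hv => ?_, fun u hu v huv =>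
    Finset.mem_coe.1 (hclosed.reachable hu huv)⟩
  have hus : L.Reachable u s := (Finset.mem_union.1 hu).elim (fun h => hA' u h s hsA)
    fun h => hB' u h s hsB
  have hsv : L.Reachable s v := (Finset.mem_union.1 hv).elim (fun h => hA' s hsA v h)
    fun h => hB' s hsB v h
  exact hus.trans hsv

theorem maximal_isEC_unique (hnonneg : ∀ s t, 0 ≤ I.lo s t) {A B : Finset S}
    (hA : Maximal I.IsEC A) (hB : Maximal I.IsEC B) {s : S} (hsA : s ∈ A) (hsB : s ∈ B) :
    A = B := by
  classical
  have h := hA.1.union hnonneg hB.1 hsA hsB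
  exact (hA.eq_of_ge h Finset.subset_union_left).symm.trans
    (hB.eq_of_ge h Finset.subset_union_right)

theorem IsEC.mem_bad (hnonneg : ∀ s t, 0 ≤ I.lo s t) (hMC : I.inducedMCs.Nonempty) {good : Set S}
    {B : Finset S} (hB : I.IsEC B) {s t : S} (hs : s ∈ B) (ht : t ∈ B) (hbad : s ∈ I.bad good) :
    t ∈ I.bad good := by
  obtain ⟨M, hM, hMB⟩ := hB
  exact mem_bad_of_reflTransGen hnonneg hMC hbad
    (reflTransGen_of_mem hM (hMB.2.1 s hs t ht))

theorem IsEC.exists_elimMEC (hnonneg : ∀ s t, 0 ≤ I.lo s t) (hMC : I.inducedMCs.Nonempty)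
    {good : Set S} (hgood : ∀ B, I.IsEC B → (∃ s ∈ B, s ∈ good) → ∀ s ∈ B, s ∈ good)
    {W : Finset S} (hW : I.IsEC W) {s : S} (hs : s ∈ W) (hsg : s ∉ good)
    (hsb : s ∉ I.bad good) : ∃ B ∈ I.elimMECs good, W ⊆ B := by
  obtain ⟨B, hWB, hB⟩ := Finite.exists_le_maximal hW
  refine ⟨B, ⟨hB, fun t ht htgb => ?_⟩, hWB⟩
  rcases htgb with h | h
  · exact hsg (hgood B hB.1 ⟨t, ht, h⟩ s (hWB hs))
  · exact hsb (hB.1.mem_bad hnonneg hMC ht (hWB hs) h)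

end IMC

/-! ### States and rows of the elimination -/

namespace IMC

variable {S : Type*} [Fintype S] {I : IMC S} {good : Set S}

theorem elimState_of_mem (hnonneg : ∀ s t, 0 ≤ I.lo s t) {B : Finset S}
    (hB : B ∈ I.elimMECs good) {s : S} (hs : s ∈ B) : I.elimState good s = B := by
  have h : ∃ B ∈ I.elimMECs good, s ∈ B := ⟨B, hB, hs⟩
  rw [elimState, dif_pos h]
  exact maximal_isEC_unique hnonneg h.choose_spec.1.1 hB.1 h.choose_spec.2 hs

theorem mem_elimState (s : S) : s ∈ I.elimState good s := by
  by_cases h : ∃ B ∈ I.elimMECs good, s ∈ B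
  · rw [elimState, dif_pos h]
    exact h.choose_spec.2
  · rw [elimState, dif_neg h]
    exact Finset.mem_singleton_self s

theorem elimState_of_notMem {s : S} (h : I.elimState good s ∉ I.elimMECs good) :
    I.elimState good s = {s} := by
  by_cases h' : ∃ B ∈ I.elimMECs good, s ∈ B
  · rw [elimState, dif_pos h'] at h
    exact absurd h'.choose_spec.1 h
  · rw [elimState, dif_neg h']

theorem elimState_eq_of_mem (hnonneg : ∀ s t, 0 ≤ I.lo s t) {s t : S}
    (h : t ∈ I.elimState good s) : I.elimState good t = I.elimState good s := by
  by_cases hs : I.elimState good s ∈ I.elimMECs good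
  · exact elimState_of_mem hnonneg hs h
  · rw [elimState_of_notMem hs, Finset.mem_singleton] at h
    rw [h]

theorem exists_toElim_eq (A : I.ElimStates good) : ∃ s, I.toElim good s = A := by
  classical
  obtain ⟨A, hA⟩ := A
  obtain ⟨s, -, hs⟩ := Finset.mem_image.1 hA
  exact ⟨s, Subtype.ext hs⟩

theorem mem_toElim (s : S) : s ∈ (I.toElim good s).1 := mem_elimState s

/-- The states of the elimination partition the original states. -/
theorem mem_iff_toElim_eq (hnonneg : ∀ s t, 0 ≤ I.lo s t) {A : I.ElimStates good} {t : S} :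
    t ∈ A.1 ↔ I.toElim good t = A := by
  constructor
  · intro h
    obtain ⟨s, rfl⟩ := exists_toElim_eq A
    exact Subtype.ext (elimState_eq_of_mem hnonneg h)
  · rintro rfl
    exact mem_toElim t

theorem notMem_of_mem_elimMECs {B : Finset S} (hB : B ∈ I.elimMECs good) {s : S} (hs : s ∈ B) :
    s ∉ good ∧ s ∉ I.bad good :=
  ⟨fun h => hB.2 s hs (.inl h), fun h => hB.2 s hs (.inr h)⟩

theorem toElim_eq_singleton {s : S} (hs : s ∈ good ∨ s ∈ I.bad good) :
    (I.toElim good s).1 = {s} :=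
  elimState_of_notMem fun h => by
    have := notMem_of_mem_elimMECs h (mem_elimState s)
    exact hs.elim this.1 this.2

theorem sum_elimStates (hnonneg : ∀ s t, 0 ≤ I.lo s t) (f : S → ℝ) :
    ∑ B : I.ElimStates good, ∑ t ∈ B.1, f t = ∑ t, f t := by
  classical
  rw [← Finset.sum_fiberwise Finset.univ (I.toElim good) f]
  refine Finset.sum_congr rfl fun B _ => Finset.sum_congr ?_ fun _ _ => rfl
  ext t
  simp [mem_iff_toElim_eq hnonneg]

theorem sum_elimStates_mul (hnonneg : ∀ s t, 0 ≤ I.lo s t) (a : S → ℝ)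
    (x : I.ElimStates good → ℝ) :
    ∑ B : I.ElimStates good, (∑ t ∈ B.1, a t) * x B = ∑ t, a t * x (I.toElim good t) := by
  rw [← sum_elimStates hnonneg]
  refine Finset.sum_congr rfl fun B _ => ?_
  rw [Finset.sum_mul]
  refine Finset.sum_congr rfl fun t ht => ?_
  rw [(mem_iff_toElim_eq hnonneg).1 ht]

theorem elim_lo_nonneg (hnonneg : ∀ s t, 0 ≤ I.lo s t) (A B : I.ElimStates good) :
    0 ≤ (I.elim good).lo A B := by
  unfold elim
  dsimp only
  split_ifs
  · exact le_rfl
  · exact Finset.sum_nonneg fun s _ => Finset.sum_nonneg fun t _ => hnonneg s t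

theorem elim_lo_of_notMem {s : S} (hs : (I.toElim good s).1 ∉ I.elimMECs good)
    (B : I.ElimStates good) :
    (((I.elim good).lo (I.toElim good s) B : ℚ) : ℝ) = ∑ t ∈ B.1, (I.lo s t : ℝ) := by
  have hs' : (I.toElim good s).1 = {s} := elimState_of_notMem hs
  simp only [elim, if_neg hs]
  rw [hs', setLo, Finset.sum_singleton, Rat.cast_sum]

theorem elim_hi_of_notMem {s : S} (hs : (I.toElim good s).1 ∉ I.elimMECs good)
    (B : I.ElimStates good) :
    (((I.elim good).hi (I.toElim good s) B : ℚ) : ℝ) = ∑ t ∈ B.1, (I.hi s t : ℝ) := by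
  have hs' : (I.toElim good s).1 = {s} := elimState_of_notMem hs
  simp only [elim, if_neg hs]
  rw [hs', setHi, Finset.sum_singleton, Rat.cast_sum]

/-- A row of a state that is not eliminated induces a row of the elimination. -/
theorem IsRow.toElim (hnonneg : ∀ s t, 0 ≤ I.lo s t) {s : S}
    (hs : (I.toElim good s).1 ∉ I.elimMECs good) {a : S → ℝ} (ha : I.IsRow s a) :
    (I.elim good).IsRow (I.toElim good s) fun B => ∑ t ∈ B.1, a t := by
  refine ⟨fun B => ?_, ?_⟩
  · rw [elim_lo_of_notMem hs, elim_hi_of_notMem hs]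
    exact ⟨Finset.sum_le_sum fun t _ => (ha.1 t).1, Finset.sum_le_sum fun t _ => (ha.1 t).2⟩
  · rw [sum_elimStates hnonneg, ha.2]

/-- A row of the elimination at a state that is not eliminated is induced by an original row. -/
theorem IsRow.exists_lift (hnonneg : ∀ s t, 0 ≤ I.lo s t) {s : S}
    (hs : (I.toElim good s).1 ∉ I.elimMECs good) {α : I.ElimStates good → ℝ}
    (hα : (I.elim good).IsRow (I.toElim good s) α) :
    ∃ a, I.IsRow s a ∧ ∀ B : I.ElimStates good, ∑ t ∈ B.1, a t = α B := by
  have hle : ∀ t, (I.lo s t : ℝ) ≤ (I.hi s t : ℝ) := fun t => by exact_mod_cast I.lo_le_hi s t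
  choose c hc hsum using fun B : I.ElimStates good =>
    exists_bounded_sum_eq B.1 hle (elim_lo_of_notMem hs B ▸ (hα.1 B).1)
      (elim_hi_of_notMem hs B ▸ (hα.1 B).2)
  have hB : ∀ B : I.ElimStates good, ∑ t ∈ B.1, c (I.toElim good t) t = α B := by
    intro B
    rw [← hsum B]
    refine Finset.sum_congr rfl fun t ht => ?_
    rw [(mem_iff_toElim_eq hnonneg).1 ht]
  refine ⟨fun t => c (I.toElim good t) t, ⟨fun t => hc _ t, ?_⟩, hB⟩
  rw [← sum_elimStates (good := good) hnonneg]
  simp_rw [hB]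
  exact hα.2

open Classical in
theorem isRow_single {A B : I.ElimStates good} (hA : A.1 ∈ I.elimMECs good)
    (hAB : I.ElimEdge good A.1 B.1) : (I.elim good).IsRow A (Pi.single B 1) := by
  refine ⟨fun C => ?_, by simp⟩
  simp only [elim, if_pos hA]
  by_cases hC : C = B
  · subst hC
    simp [hAB]
  · rw [Pi.single_eq_of_ne hC]
    split_ifs <;> simp

theorem IsRow.elimEdge {A B : I.ElimStates good} (hA : A.1 ∈ I.elimMECs good)
    {α : I.ElimStates good → ℝ} (hα : (I.elim good).IsRow A α) (hB : 0 < α B) :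
    I.ElimEdge good A.1 B.1 := by
  by_contra h
  have := (hα.1 B).2
  simp only [elim, if_pos hA, if_neg h, Rat.cast_zero] at this
  exact hB.not_ge this

theorem exists_elimEdge (hbad : (I.elimMECs good).Nonempty → (I.bad good).Nonempty)
    {A : I.ElimStates good} (hA : A.1 ∈ I.elimMECs good) :
    ∃ b ∈ I.bad good, I.ElimEdge good A.1 (I.toElim good b).1 := by
  obtain ⟨b, hb⟩ := hbad ⟨_, hA⟩
  exact ⟨b, hb, .inr ⟨b, mem_toElim b, hb⟩⟩

theorem elim_inducedMCs_nonempty (hnonneg : ∀ s t, 0 ≤ I.lo s t) (hMC : I.inducedMCs.Nonempty)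
    (hbad : (I.elimMECs good).Nonempty → (I.bad good).Nonempty) :
    (I.elim good).inducedMCs.Nonempty := by
  classical
  obtain ⟨M, hM⟩ := hMC
  have hrow : ∀ A : I.ElimStates good, ∃ α, (I.elim good).IsRow A α := by
    intro A
    by_cases hA : A.1 ∈ I.elimMECs good
    · obtain ⟨b, -, hb⟩ := exists_elimEdge hbad hA
      exact ⟨_, isRow_single hA hb⟩
    · obtain ⟨s, rfl⟩ := exists_toElim_eq A
      exact ⟨_, (isRow_of_mem hM s).toElim hnonneg hA⟩
  choose α hα using hrow
  obtain ⟨N, hN, -⟩ := exists_mem_of_rows (elim_lo_nonneg hnonneg) hα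
  exact ⟨N, hN⟩

/-- Transitions between different states of the elimination that have a positive probability in
`I` are edges of the elimination. -/
theorem CanStep.elimEdge (hnonneg : ∀ s t, 0 ≤ I.lo s t) {s t : S} (hst : I.CanStep s t)
    (hne : I.toElim good s ≠ I.toElim good t) :
    I.ElimEdge good (I.toElim good s).1 (I.toElim good t).1 := by
  obtain ⟨a, ha, hat⟩ := hst
  have hhi : 0 < I.hi s t := by exact_mod_cast hat.trans_le (ha.1 t).2
  have hnn : ∀ u v, 0 ≤ I.hi u v := fun u v => (hnonneg u v).trans (I.lo_le_hi u v)
  refine .inl ⟨fun h => hne (Subtype.ext h), fun h => h.2.not_gt ?_⟩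
  exact Finset.sum_pos' (fun u _ => Finset.sum_nonneg fun v _ => hnn u v)
    ⟨s, mem_toElim s, Finset.sum_pos' (fun v _ => hnn s v) ⟨t, mem_toElim t, hhi⟩⟩

theorem CanStep.toElim (hnonneg : ∀ s t, 0 ≤ I.lo s t) {s t : S} (hst : I.CanStep s t)
    (hne : I.toElim good s ≠ I.toElim good t) :
    (I.elim good).CanStep (I.toElim good s) (I.toElim good t) := by
  classical
  by_cases hs : (I.toElim good s).1 ∈ I.elimMECs good
  · exact ⟨_, isRow_single hs (hst.elimEdge hnonneg hne), by simp⟩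
  · obtain ⟨a, ha, hat⟩ := hst
    exact ⟨_, ha.toElim hnonneg hs,
      Finset.sum_pos' (fun u _ => ha.nonneg hnonneg u) ⟨t, mem_toElim t, hat⟩⟩

theorem toElim_mem_elimGood {s : S} : I.toElim good s ∈ I.elimGood good ↔ s ∈ good := by
  refine ⟨?_, fun h => ⟨s, h, rfl⟩⟩
  rintro ⟨g, hg, hgs⟩
  have h : s ∈ (I.toElim good g).1 := hgs ▸ mem_toElim s
  rw [toElim_eq_singleton (.inl hg), Finset.mem_singleton] at h
  exact h ▸ hg

/-- The bad states of the elimination are exactly those that represent bad states. -/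
theorem toElim_mem_bad (hnonneg : ∀ s t, 0 ≤ I.lo s t) (hMC : I.inducedMCs.Nonempty)
    (hbad : (I.elimMECs good).Nonempty → (I.bad good).Nonempty) {s : S} :
    I.toElim good s ∈ (I.elim good).bad (I.elimGood good) ↔ s ∈ I.bad good := by
  have hMC' := elim_inducedMCs_nonempty hnonneg hMC hbad
  have hnonneg' := elim_lo_nonneg (good := good) hnonneg
  rw [mem_bad_iff hnonneg' hMC']
  constructor
  · refine fun h => (mem_bad_iff hnonneg hMC).2 fun t hst ht => ?_
    refine h (I.toElim good t) ?_ (toElim_mem_elimGood.2 ht)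
    clear h ht
    induction hst with
    | refl => exact .refl
    | @tail u v _ huv ih =>
      by_cases hne : I.toElim good u = I.toElim good v
      · exact hne ▸ ih
      · exact ih.tail (huv.toElim hnonneg hne)
  · intro hs B hB
    -- the representatives of bad states are closed under the transitions of the elimination
    suffices h : ∃ t ∈ I.bad good, I.toElim good t = B by
      obtain ⟨t, ht, rfl⟩ := h
      exact fun hg => notMem_bad_of_mem_good hMC (toElim_mem_elimGood.1 hg) ht
    induction hB with
    | refl => exact ⟨s, hs, rfl⟩
    | @tail C D _ hCD ih =>
      obtain ⟨u, hu, rfl⟩ := ih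
      obtain ⟨α, hα, hD⟩ := hCD
      have huE : (I.toElim good u).1 ∉ I.elimMECs good := fun h =>
        (notMem_of_mem_elimMECs h (mem_toElim u)).2 hu
      obtain ⟨a, ha, hsum⟩ := hα.exists_lift hnonneg huE
      rw [← hsum D] at hD
      obtain ⟨t, htD, hat⟩ := Finset.exists_lt_of_sum_lt (f := fun _ => (0 : ℝ)) (by simpa using hD)
      exact ⟨t, mem_bad_of_canStep hnonneg hMC hu ⟨a, ha, hat⟩, (mem_iff_toElim_eq hnonneg).1 htD⟩

end IMC

/-! ### Lifting Markov chains from the elimination -/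

namespace IMC

variable {S : Type*} [Fintype S] {I : IMC S} {good : Set S}

/-- If a row stays inside of `A`, and the transition from `s` to `t ∉ A` is possible at all, then
the row can be modified so that it leaves `A` through `t` only, without losing a transition. -/
theorem exists_exit_row (hnonneg : ∀ s t, 0 ≤ I.lo s t) {A : Finset S} {s t : S} {m : S → ℝ}
    (hm : I.IsRow s m) (hmA : ∑ u ∈ A, m u = 1) (htA : t ∉ A) (hst : I.CanStep s t) :
    ∃ q, I.IsRow s q ∧ (∀ u, 0 < m u → 0 < q u) ∧ 0 < q t ∧ ∀ u, 0 < q u → u ∈ A ∨ u = t := by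
  classical
  obtain ⟨p, hp, hpt⟩ := hst
  have hle : ∀ u, (I.lo s u : ℝ) ≤ (I.hi s u : ℝ) := fun u => by exact_mod_cast I.lo_le_hi s u
  have hlo : ∀ u, (0 : ℝ) ≤ I.lo s u := fun u => by exact_mod_cast hnonneg s u
  have hm0 : ∀ u, u ∉ A → m u = 0 := by
    have h := Finset.sum_add_sum_compl A m
    rw [hm.2, hmA, add_eq_left,
      Finset.sum_eq_zero_iff_of_nonneg fun u _ => hm.nonneg hnonneg u] at h
    exact fun u hu => h u (Finset.mem_compl.2 hu)
  have hpA : ∑ u ∈ A, p u ≤ 1 - p t := by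
    have h : ∑ u ∈ insert t A, p u ≤ ∑ u, p u :=
      Finset.sum_le_univ_sum_of_nonneg fun u => hp.nonneg hnonneg u
    rw [Finset.sum_insert htA, hp.2] at h
    linarith
  -- keep the probability that `p` assigns to `t`, and distribute the rest within `A`
  obtain ⟨c, hc, hcsum⟩ := exists_bounded_sum_eq A hle (v := 1 - p t)
    ((Finset.sum_le_sum fun u _ => (hp.1 u).1).trans hpA)
    (by
      have := Finset.sum_le_sum fun u (_ : u ∈ A) => (hm.1 u).2
      linarith)
  have hrow : I.IsRow s fun u => if u ∈ A then c u else if u = t then p t else 0 := by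
    refine ⟨fun u => ?_, ?_⟩
    · dsimp only
      split_ifs with h1 h2
      · exact hc u
      · exact h2 ▸ hp.1 t
      · exact ⟨(hm.1 u).1.trans (hm0 u h1).le, (hlo u).trans (hle u)⟩
    · rw [← Finset.sum_subset (Finset.subset_univ (insert t A)), Finset.sum_insert htA,
        if_neg htA, if_pos rfl, Finset.sum_congr rfl fun u hu => if_pos hu, hcsum]
      · ring
      · intro u _ hu
        rw [Finset.mem_insert, not_or] at hu
        rw [if_neg hu.2, if_neg hu.1]
  obtain ⟨q, hq, hpos⟩ := hm.exists_mean hnonneg hrow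
  refine ⟨q, hq, fun u hu => (hpos u).2 (.inl hu), (hpos t).2 (.inr ?_), fun u hu => ?_⟩
  · simpa [htA] using hpt
  · by_contra! h
    rcases (hpos u).1 hu with h' | h'
    · exact h'.ne' (hm0 u h.1)
    · simp [h.1, h.2] at h'

/-- An edge of the elimination from an eliminated end component `A` to `B` is realized by a Markov
chain that moves within `A ∪ B` and eventually leaves `A`, except that the chain stays in `A` for
ever if `B` represents a bad state. -/
theorem exists_exit_chain (hnonneg : ∀ s t, 0 ≤ I.lo s t)
    (hexit : ∀ B ∈ I.elimMECs good, ∀ s ∈ B, ∀ t, t ∉ B →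
      ¬ (I.lo s t = 0 ∧ I.hi s t = 0) → ∃ M ∈ I.inducedMCs, 0 < M.prob s t)
    {A B : I.ElimStates good} (hA : A.1 ∈ I.elimMECs good) (hAB : I.ElimEdge good A.1 B.1) :
    ∃ N ∈ I.inducedMCs, (∀ s ∈ A.1, ∀ t, 0 < N.prob s t → t ∈ A.1 ∨ t ∈ B.1) ∧
      ((∃ b ∈ B.1, b ∈ I.bad good) ∨
        ∀ W : Set S, N.IsClosed W → W.Nonempty → ¬ W ⊆ (A.1 : Set S)) := by
  classical
  obtain ⟨M, hM, hMA⟩ := hA.1.1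
  rcases hAB with ⟨hne, hedge⟩ | hb
  · obtain ⟨s, hs, t, ht, hst⟩ : ∃ s ∈ A.1, ∃ t ∈ B.1, ¬ (I.lo s t = 0 ∧ I.hi s t = 0) := by
      by_contra! h
      exact hedge ⟨Finset.sum_eq_zero fun s hs => Finset.sum_eq_zero fun t ht => (h s hs t ht).1,
        Finset.sum_eq_zero fun s hs => Finset.sum_eq_zero fun t ht => (h s hs t ht).2⟩
    have htA : t ∉ A.1 := fun htA => hne (by
      rw [← (mem_iff_toElim_eq hnonneg).1 ht, ← (mem_iff_toElim_eq hnonneg).1 htA])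
    obtain ⟨P, hP, hPst⟩ := hexit A.1 hA s hs t htA hst
    obtain ⟨q, hq, hMq, hqt, hqA⟩ := exists_exit_row hnonneg (isRow_of_mem hM s)
      (MarkovChain.sum_prob_eq_one fun u hu => hMA.isClosed s hs u hu) htA
      (canStep_of_mem hP hPst)
    obtain ⟨N, hN, hNr⟩ := exists_mem_of_rows hnonneg
      (r := fun u => if u = s then q else M.prob u) (fun u => by
        split_ifs with h
        exacts [h ▸ hq, isRow_of_mem hM u])
    refine ⟨N, hN, fun u hu v huv => ?_, .inr fun W hW ⟨w, hw⟩ hWA => ?_⟩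
    · by_cases hus : u = s
      · simp only [hNr, if_pos hus] at huv
        exact (hqA v huv).imp id fun (h : v = t) => h ▸ ht
      · simp only [hNr, if_neg hus] at huv
        exact .inl (hMA.isClosed u hu v huv)
    · have hws : N.Reachable w s := by
        refine .of_isClosed hMA.isClosed (fun u _ v huv => ?_) (hWA hw) (hMA.2.1 w (hWA hw) s hs)
        by_cases hus : u = s
        · simp only [hNr, if_pos hus]
          exact hMq v (hus ▸ huv)
        · simpa only [hNr, if_neg hus] using huv
      refine htA (hWA (hW s (hW.reachable hw hws) t ?_))
      simpa only [hNr, ↓reduceIte] using hqt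
  · exact ⟨M, hM, fun s hs t hst => .inl (hMA.isClosed s hs t hst), .inl hb⟩

/-- Every Markov chain `N` of the elimination is simulated by a chain of `I`. States that are not
eliminated follow `N`. In an eliminated end component, one transition of `N`, given by `β`, is
selected: the lifted chain takes it eventually, or stays for ever if it leads to a bad state. So a
bottom component without target and bad states can only be a part of an end component in which `β`
selects a bad state. -/
theorem exists_lift (hnonneg : ∀ s t, 0 ≤ I.lo s t) (hMC : I.inducedMCs.Nonempty)
    (hgood : ∀ B, I.IsEC B → (∃ s ∈ B, s ∈ good) → ∀ s ∈ B, s ∈ good)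
    (hexit : ∀ B ∈ I.elimMECs good, ∀ s ∈ B, ∀ t, t ∉ B →
      ¬ (I.lo s t = 0 ∧ I.hi s t = 0) → ∃ M ∈ I.inducedMCs, 0 < M.prob s t)
    {N : MarkovChain (I.ElimStates good)} (hN : N ∈ (I.elim good).inducedMCs) :
    ∃ M ∈ I.inducedMCs, ∃ β : I.ElimStates good → I.ElimStates good,
      (∀ A, 0 < N.prob A (β A)) ∧
      (∀ s, (I.toElim good s).1 ∉ I.elimMECs good → ∀ B : I.ElimStates good,
        ∑ t ∈ B.1, M.prob s t = N.prob (I.toElim good s) B) ∧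
      (∀ s, (I.toElim good s).1 ∈ I.elimMECs good → ∀ t, 0 < M.prob s t →
        I.toElim good t = I.toElim good s ∨ I.toElim good t = β (I.toElim good s)) ∧
      ∀ W : Finset S, M.IsBSCC W → (∀ s ∈ W, s ∉ good ∧ s ∉ I.bad good) →
        ∃ s ∈ W, (I.toElim good s).1 ∈ I.elimMECs good ∧
          ∃ b ∈ I.bad good, β (I.toElim good s) = I.toElim good b := by
  classical
  choose β hβ using fun A => N.exists_prob_pos A
  choose L hL hLstay hLexit using fun (A : I.ElimStates good) (hA : A.1 ∈ I.elimMECs good) =>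
    exists_exit_chain hnonneg hexit hA ((isRow_of_mem hN A).elimEdge hA (hβ A))
  choose r hr hrsum using fun (s : S) (hs : (I.toElim good s).1 ∉ I.elimMECs good) =>
    (isRow_of_mem hN (I.toElim good s)).exists_lift hnonneg hs
  obtain ⟨M, hM, hMr⟩ := exists_mem_of_rows hnonneg
    (r := fun s => if hs : (I.toElim good s).1 ∈ I.elimMECs good then
      (L (I.toElim good s) hs).prob s else r s hs) (fun s => by
      split_ifs with hs
      exacts [isRow_of_mem (hL _ hs) s, hr s hs])
  refine ⟨M, hM, β, hβ, fun s hs B => ?_, fun s hs t hst => ?_, fun W hW hWd => ?_⟩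
  · simp only [hMr, dif_neg hs]
    exact hrsum s hs B
  · simp only [hMr, dif_pos hs] at hst
    exact (hLstay _ hs s (mem_toElim s) t hst).imp (mem_iff_toElim_eq hnonneg).1
      (mem_iff_toElim_eq hnonneg).1
  · obtain ⟨s, hs⟩ := hW.1
    obtain ⟨A, hA, hWA⟩ := IsEC.exists_elimMEC hnonneg hMC hgood ⟨M, hM, hW⟩ hs (hWd s hs).1
      (hWd s hs).2
    have hAs : ∀ u ∈ A, (I.toElim good u).1 = A := fun u hu => elimState_of_mem hnonneg hA hu
    have hsE : (I.toElim good s).1 ∈ I.elimMECs good := (hAs s (hWA hs)).symm ▸ hA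
    refine ⟨s, hs, hsE, ?_⟩
    rcases hLexit _ hsE with ⟨b, hb, hbad⟩ | h
    · exact ⟨b, hbad, ((mem_iff_toElim_eq hnonneg).1 hb).symm⟩
    · refine absurd ?_ (h (W : Set S) (fun u hu v huv => hW.isClosed u hu v ?_) ⟨s, hs⟩)
      · rw [hAs s (hWA hs)]
        exact Finset.coe_subset.2 hWA
      · have hus : I.toElim good u = I.toElim good s :=
          Subtype.ext ((hAs u (hWA hu)).trans (hAs s (hWA hs)).symm)
        have huE : (I.toElim good u).1 ∈ I.elimMECs good := hus ▸ hsE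
        simp only [hMr, dif_pos huE]
        convert huv using 3

/-- The elimination has no end components besides those that contain target or bad states. -/
theorem elim_isBSCC_meets (hnonneg : ∀ s t, 0 ≤ I.lo s t) (hMC : I.inducedMCs.Nonempty)
    (hgood : ∀ B, I.IsEC B → (∃ s ∈ B, s ∈ good) → ∀ s ∈ B, s ∈ good)
    (hbad : (I.elimMECs good).Nonempty → (I.bad good).Nonempty)
    (hexit : ∀ B ∈ I.elimMECs good, ∀ s ∈ B, ∀ t, t ∉ B →
      ¬ (I.lo s t = 0 ∧ I.hi s t = 0) → ∃ M ∈ I.inducedMCs, 0 < M.prob s t)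
    {N : MarkovChain (I.ElimStates good)} (hN : N ∈ (I.elim good).inducedMCs)
    {C : Finset (I.ElimStates good)} (hC : N.IsBSCC C) :
    ∃ A ∈ C, A ∈ I.elimGood good ∨ A ∈ (I.elim good).bad (I.elimGood good) := by
  by_contra! h
  obtain ⟨M, hM, β, hβ, hrow, hstay, hbscc⟩ := exists_lift hnonneg hMC hgood hexit hN
  -- the states that are represented in `C` form a closed set of the lifted chain
  have hclosed : M.IsClosed {s | I.toElim good s ∈ C} := by
    intro s hs t hst
    by_cases hsE : (I.toElim good s).1 ∈ I.elimMECs good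
    · rcases hstay s hsE t hst with h' | h'
      · exact (h' ▸ hs : I.toElim good t ∈ C)
      · exact (h' ▸ hC.isClosed _ hs _ (hβ _) : I.toElim good t ∈ C)
    · refine hC.isClosed _ hs _ ?_
      rw [← hrow s hsE]
      exact Finset.sum_pos' (fun u _ => M.prob_nonneg s u) ⟨t, mem_toElim t, hst⟩
  obtain ⟨A, hA⟩ := hC.1
  obtain ⟨s, rfl⟩ := exists_toElim_eq A
  obtain ⟨W, hW, hWC⟩ := hclosed.exists_isBSCC ⟨s, hA⟩
  obtain ⟨u, hu, -, b, hb, hβb⟩ := hbscc W hW fun u hu =>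
    ⟨fun hg => (h _ (hWC u hu)).1 (toElim_mem_elimGood.2 hg),
      fun hb => (h _ (hWC u hu)).2 ((toElim_mem_bad hnonneg hMC hbad).2 hb)⟩
  refine (h _ (hC.isClosed _ (hWC u hu) _ (hβ _))).2 ?_
  rw [hβb]
  exact (toElim_mem_bad hnonneg hMC hbad).2 hb

end IMC

/-! ### Bellman equations -/

namespace Opt

theorem exists_isOptimum (opt : Opt) {A : Set ℝ} (hA : IsCompact A) (hne : A.Nonempty) :
    ∃ v, opt.IsOptimum A v := by
  cases opt
  exacts [hA.exists_isLeast hne, hA.exists_isGreatest hne]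

theorem IsOptimum.mem {opt : Opt} {A : Set ℝ} {v : ℝ} (h : opt.IsOptimum A v) : v ∈ A := by
  cases opt
  exacts [And.left h, And.left h]

theorem IsOptimum.image_mono {α : Type*} {opt : Opt} {R : Set α} {f g : α → ℝ} {v w : ℝ}
    (hv : opt.IsOptimum (f '' R) v) (hw : opt.IsOptimum (g '' R) w) (h : ∀ a ∈ R, f a ≤ g a) :
    v ≤ w := by
  cases opt
  · obtain ⟨a, ha, hwa⟩ := hw.mem
    exact (And.right hv ⟨a, ha, rfl⟩).trans ((h a ha).trans hwa.le)
  · obtain ⟨a, ha, hva⟩ := hv.mem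
    exact hva.ge.trans ((h a ha).trans (And.right hw ⟨a, ha, rfl⟩))

end Opt

namespace IMC

variable {S : Type*} [Fintype S] {I : IMC S} {good : Set S}

/-- The set that is optimized in the system of equations. -/
theorem bellman_set_eq (s : S) (x : S → ℝ) :
    {v | ∃ a : S → ℝ, (∀ t, (I.lo s t : ℝ) ≤ a t ∧ a t ≤ (I.hi s t : ℝ)) ∧
        ∑ t, a t = 1 ∧ v = ∑ t, a t * x t} =
      (fun a : S → ℝ => ∑ t, a t * x t) '' {a | I.IsRow s a} := by
  ext v
  constructor
  · rintro ⟨a, h1, h2, rfl⟩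
    exact ⟨a, ⟨h1, h2⟩, rfl⟩
  · rintro ⟨a, ⟨h1, h2⟩, rfl⟩
    exact ⟨a, h1, h2, rfl⟩

theorem isCompact_isRow (s : S) : IsCompact {a | I.IsRow s a} := by
  have h : {a | I.IsRow s a} =
      (Set.univ.pi fun t => Set.Icc (I.lo s t : ℝ) (I.hi s t)) ∩ {a | ∑ t, a t = 1} := by
    ext a
    simp only [IsRow, Set.mem_ofPred_eq, Set.mem_inter_iff, Set.mem_univ_pi, Set.mem_Icc]
  rw [h]
  exact (isCompact_univ_pi fun t => isCompact_Icc).inter_right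
    (isClosed_eq (by fun_prop) continuous_const)

theorem exists_optimal_value (hMC : I.inducedMCs.Nonempty) (opt : Opt) (s : S) (x : S → ℝ) :
    ∃ v, opt.IsOptimum ((fun a : S → ℝ => ∑ t, a t * x t) '' {a | I.IsRow s a}) v := by
  obtain ⟨M, hM⟩ := hMC
  exact opt.exists_isOptimum ((isCompact_isRow s).image (by fun_prop))
    ⟨_, _, isRow_of_mem hM s, rfl⟩

/-- The system of equations has a nonnegative solution, as the right-hand sides are a monotone
function on the complete lattice `[0, 1]^S`. -/
theorem exists_solvesSystem (hnonneg : ∀ s t, 0 ≤ I.lo s t) (hMC : I.inducedMCs.Nonempty)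
    (opt : Opt) : ∃ x : S → ℝ, I.SolvesSystem good opt x ∧ ∀ s, 0 ≤ x s := by
  classical
  choose f hf using fun (x : S → ℝ) (s : S) => exists_optimal_value hMC opt s x
  have hf01 : ∀ (x : S → Set.Icc (0 : ℝ) 1) (s : S), f (fun t => x t) s ∈ Set.Icc (0 : ℝ) 1 := by
    intro x s
    obtain ⟨a, ha, hfa⟩ := (hf (fun t => x t) s).mem
    rw [← hfa]
    refine ⟨Finset.sum_nonneg fun t _ => mul_nonneg (ha.nonneg hnonneg t) (x t).2.1, ?_⟩
    exact (Finset.sum_le_sum fun t _ =>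
      mul_le_of_le_one_right (ha.nonneg hnonneg t) (x t).2.2).trans ha.2.le
  let T : (S → Set.Icc (0 : ℝ) 1) →o (S → Set.Icc (0 : ℝ) 1) :=
    { toFun := fun x s =>
        if s ∈ good then 1 else if s ∈ I.bad good then 0 else ⟨f (fun t => x t) s, hf01 x s⟩
      monotone' := by
        intro x y hxy s
        dsimp only
        split_ifs
        · exact le_rfl
        · exact le_rfl
        · exact (hf _ s).image_mono (hf _ s) fun a ha => Finset.sum_le_sum fun t _ =>
            mul_le_mul_of_nonneg_left (hxy t) (ha.nonneg hnonneg t) }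
  have hT : ∀ s, T.lfp s = if s ∈ good then 1 else if s ∈ I.bad good then 0 else
      ⟨f (fun t => T.lfp t) s, hf01 T.lfp s⟩ := fun s => (congrFun T.map_lfp s).symm
  refine ⟨fun s => T.lfp s, ⟨fun s hs => ?_, fun s hs => ?_, fun s hs hsb => ?_⟩,
    fun s => (T.lfp s).2.1⟩
  · dsimp only
    rw [hT, if_pos hs]
    rfl
  · dsimp only
    rw [hT, if_neg fun h => notMem_bad_of_mem_good hMC h hs, if_pos hs]
    rfl
  · rw [bellman_set_eq]
    have h : (T.lfp s : ℝ) = f (fun t => T.lfp t) s := by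
      rw [hT, if_neg hs, if_neg hsb]
    simp only [h]
    exact hf _ s

theorem SolvesSystem.isOptimum {opt : Opt} {x : S → ℝ} (hx : I.SolvesSystem good opt x) {s : S}
    (hs : s ∉ good) (hsb : s ∉ I.bad good) :
    opt.IsOptimum ((fun a : S → ℝ => ∑ t, a t * x t) '' {a | I.IsRow s a}) (x s) :=
  bellman_set_eq s x ▸ hx.2.2 s hs hsb

/-- At bad states, all rows attain the value `0`. -/
theorem sum_eq_zero_of_mem_bad (hnonneg : ∀ s t, 0 ≤ I.lo s t) (hMC : I.inducedMCs.Nonempty)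
    {x : S → ℝ} (hx : ∀ s ∈ I.bad good, x s = 0) {s : S} (hs : s ∈ I.bad good) {a : S → ℝ}
    (ha : I.IsRow s a) : ∑ t, a t * x t = 0 := by
  refine Finset.sum_eq_zero fun t _ => ?_
  rcases (ha.nonneg hnonneg t).eq_or_lt with h | h
  · rw [← h, zero_mul]
  · rw [hx t (mem_bad_of_canStep hnonneg hMC hs ⟨a, ha, h⟩), mul_zero]

theorem SolvesSystem.sum_le (hnonneg : ∀ s t, 0 ≤ I.lo s t) (hMC : I.inducedMCs.Nonempty)
    {x : S → ℝ} (hx : I.SolvesSystem good .max x) {s : S} (hs : s ∉ good) {a : S → ℝ}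
    (ha : I.IsRow s a) : ∑ t, a t * x t ≤ x s := by
  by_cases hsb : s ∈ I.bad good
  · rw [sum_eq_zero_of_mem_bad hnonneg hMC hx.2.1 hsb ha, hx.2.1 s hsb]
  · exact (hx.isOptimum hs hsb).2 ⟨a, ha, rfl⟩

theorem SolvesSystem.le_sum (hnonneg : ∀ s t, 0 ≤ I.lo s t) (hMC : I.inducedMCs.Nonempty)
    {x : S → ℝ} (hx : I.SolvesSystem good .min x) {s : S} (hs : s ∉ good) {a : S → ℝ}
    (ha : I.IsRow s a) : x s ≤ ∑ t, a t * x t := by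
  by_cases hsb : s ∈ I.bad good
  · rw [sum_eq_zero_of_mem_bad hnonneg hMC hx.2.1 hsb ha, hx.2.1 s hsb]
  · exact (hx.isOptimum hs hsb).2 ⟨a, ha, rfl⟩

/-- Some induced Markov chain attains the optima in all equations simultaneously. -/
theorem SolvesSystem.exists_optimal_chain (hnonneg : ∀ s t, 0 ≤ I.lo s t)
    (hMC : I.inducedMCs.Nonempty) {opt : Opt} {x : S → ℝ} (hx : I.SolvesSystem good opt x) :
    ∃ M ∈ I.inducedMCs, ∀ s ∉ good, x s = ∑ t, M.prob s t * x t := by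
  have hrow : ∀ s, ∃ a, I.IsRow s a ∧ (s ∉ good → x s = ∑ t, a t * x t) := by
    intro s
    by_cases hs : s ∉ good ∧ s ∉ I.bad good
    · obtain ⟨a, ha, h⟩ := (hx.isOptimum hs.1 hs.2).mem
      exact ⟨a, ha, fun _ => h.symm⟩
    · obtain ⟨M, hM⟩ := hMC
      refine ⟨_, isRow_of_mem hM s, fun hsg => ?_⟩
      have hsb : s ∈ I.bad good := by
        by_contra h
        exact hs ⟨hsg, h⟩
      rw [sum_eq_zero_of_mem_bad hnonneg ⟨M, hM⟩ hx.2.1 hsb (isRow_of_mem hM s), hx.2.1 s hsb]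
  choose r hr hrx using hrow
  obtain ⟨M, hM, rfl⟩ := exists_mem_of_rows hnonneg hr
  exact ⟨M, hM, hrx⟩

/-- If all bottom components meet target or bad states, the system of equations has at most one
solution: by the maximum principle, two solutions cannot differ. -/
theorem SolvesSystem.unique (hnonneg : ∀ s t, 0 ≤ I.lo s t) (hMC : I.inducedMCs.Nonempty)
    (hB : ∀ M ∈ I.inducedMCs, ∀ B, M.IsBSCC B → ∃ s ∈ B, s ∈ good ∨ s ∈ I.bad good) {opt : Opt}
    {x y : S → ℝ} (hx : I.SolvesSystem good opt x) (hy : I.SolvesSystem good opt y) : x = y := by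
  suffices h : ∀ x y : S → ℝ, I.SolvesSystem good opt x → I.SolvesSystem good opt y → x ≤ y from
    le_antisymm (h x y hx hy) (h y x hy hx)
  clear hx hy x y
  intro x y hx hy
  -- for `max` the chain is optimal for `x`, for `min` it is optimal for `y`
  obtain ⟨M, hM, hMd⟩ : ∃ M ∈ I.inducedMCs, ∀ s ∉ good,
      x s - y s ≤ ∑ t, M.prob s t * (x t - y t) := by
    cases opt with
    | min =>
      obtain ⟨M, hM, h⟩ := hy.exists_optimal_chain hnonneg hMC
      refine ⟨M, hM, fun s hs => ?_⟩
      simp_rw [mul_sub, Finset.sum_sub_distrib, ← h s hs]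
      exact sub_le_sub_right (hx.le_sum hnonneg hMC hs (isRow_of_mem hM s)) _
    | max =>
      obtain ⟨M, hM, h⟩ := hx.exists_optimal_chain hnonneg hMC
      refine ⟨M, hM, fun s hs => ?_⟩
      simp_rw [mul_sub, Finset.sum_sub_distrib, ← h s hs]
      exact sub_le_sub_left (hy.sum_le hnonneg hMC hs (isRow_of_mem hM s)) _
  by_contra hle
  simp only [Pi.le_def, not_forall, not_le] at hle
  obtain ⟨s, hs⟩ := hle
  obtain ⟨B, hBM, hpos⟩ := M.exists_isBSCC_pos (d := fun s => x s - y s)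
    (fun s hs => hMd s fun hsg => by simp [hx.1 s hsg, hy.1 s hsg] at hs) ⟨s, sub_pos.2 hs⟩
  obtain ⟨u, hu, hg | hb⟩ := hB M hM B hBM
  · simpa [hx.1 u hg, hy.1 u hg] using hpos u hu
  · simpa [hx.2.1 u hb, hy.2.1 u hb] using hpos u hu

/-! ### Optimal reachability probabilities -/

/-- Verification of a maximum: `x` is a supersolution for all induced Markov chains, and a
subsolution for one chain, which has no bottom component outside of the target on which `x` is
positive. -/
theorem isGreatest_reachProb {x : S → ℝ} (hx0 : ∀ s, 0 ≤ x s) (hx1 : ∀ s ∈ good, x s = 1)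
    (hle : ∀ M ∈ I.inducedMCs, ∀ s ∉ good, ∑ t, M.prob s t * x t ≤ x s)
    (hopt : ∃ M ∈ I.inducedMCs, (∀ s ∉ good, x s = ∑ t, M.prob s t * x t) ∧
      ∀ B, M.IsBSCC B → ∃ s ∈ B, s ∈ good ∨ x s ≤ 0) :
    IsGreatest ((fun M => M.reachProb good I.init) '' I.inducedMCs) (x I.init) := by
  have hub : ∀ M ∈ I.inducedMCs, ∀ s, M.reachProb good s ≤ x s := fun M hM =>
    M.reachProb_le hx0 (fun s hs => (hx1 s hs).ge) (hle M hM)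
  refine ⟨?_, by rintro _ ⟨M, hM, rfl⟩; exact hub M hM _⟩
  obtain ⟨M, hM, heq, hB⟩ := hopt
  refine ⟨M, hM, (hub M hM _).antisymm (le_of_not_gt fun hlt => ?_)⟩
  obtain ⟨B, hBM, hpos⟩ := M.exists_isBSCC_pos (d := fun s => x s - M.reachProb good s)
    (fun s hs => by
      have hsg : s ∉ good := fun h => by simp [hx1 s h, M.reachProb_of_mem h] at hs
      simp_rw [mul_sub, Finset.sum_sub_distrib, ← heq s hsg, ← M.reachProb_eq_sum hsg]
      exact le_rfl) ⟨_, sub_pos.2 hlt⟩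
  obtain ⟨u, hu, hg | h0⟩ := hB B hBM
  · simpa [hx1 u hg, M.reachProb_of_mem hg] using hpos u hu
  · linarith [hpos u hu, M.reachProb_nonneg good u]

/-- Verification of a minimum: where `x` is positive, it is a subsolution for all induced Markov
chains, and none of them has a bottom component outside of the target on which `x` is positive. For
one chain, `x` is a solution. -/
theorem isLeast_reachProb {x : S → ℝ} (hx0 : ∀ s, 0 ≤ x s) (hx1 : ∀ s ∈ good, x s = 1)
    (hle : ∀ M ∈ I.inducedMCs, ∀ s ∉ good, 0 < x s → x s ≤ ∑ t, M.prob s t * x t)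
    (hB : ∀ M ∈ I.inducedMCs, ∀ B, M.IsBSCC B → ∃ s ∈ B, s ∈ good ∨ x s ≤ 0)
    (hopt : ∃ M ∈ I.inducedMCs, ∀ s ∉ good, x s = ∑ t, M.prob s t * x t) :
    IsLeast ((fun M => M.reachProb good I.init) '' I.inducedMCs) (x I.init) := by
  have hlb : ∀ M ∈ I.inducedMCs, x I.init ≤ M.reachProb good I.init := by
    refine fun M hM => le_of_not_gt fun hlt => ?_
    obtain ⟨B, hBM, hpos⟩ := M.exists_isBSCC_pos (d := fun s => x s - M.reachProb good s)
      (fun s hs => by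
        have hsg : s ∉ good := fun h => by simp [hx1 s h, M.reachProb_of_mem h] at hs
        have hxs : 0 < x s := (M.reachProb_nonneg good s).trans_lt (sub_pos.1 hs)
        simp_rw [mul_sub, Finset.sum_sub_distrib, ← M.reachProb_eq_sum hsg]
        exact sub_le_sub_right (hle M hM s hsg hxs) _) ⟨_, sub_pos.2 hlt⟩
    obtain ⟨u, hu, hg | h0⟩ := hB M hM B hBM
    · simpa [hx1 u hg, M.reachProb_of_mem hg] using hpos u hu
    · linarith [hpos u hu, M.reachProb_nonneg good u]
  refine ⟨?_, by rintro _ ⟨M, hM, rfl⟩; exact hlb M hM⟩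
  obtain ⟨M, hM, heq⟩ := hopt
  exact ⟨M, hM, (M.reachProb_le hx0 (fun s hs => (hx1 s hs).ge) (fun s hs => (heq s hs).ge)
    _).antisymm (hlb M hM)⟩

/-- If all bottom components meet target or bad states, the solutions of the systems of equations
are the optimal reachability probabilities. -/
theorem isReachabilityInterval_of_solvesSystem (hnonneg : ∀ s t, 0 ≤ I.lo s t)
    (hMC : I.inducedMCs.Nonempty)
    (hB : ∀ M ∈ I.inducedMCs, ∀ B, M.IsBSCC B → ∃ s ∈ B, s ∈ good ∨ s ∈ I.bad good)
    {x y : S → ℝ} (hx : I.SolvesSystem good .min x) (hx0 : ∀ s, 0 ≤ x s)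
    (hy : I.SolvesSystem good .max y) (hy0 : ∀ s, 0 ≤ y s) :
    I.IsReachabilityInterval good (x I.init) (y I.init) := by
  constructor
  · refine isLeast_reachProb hx0 hx.1
      (fun M hM s hs _ => hx.le_sum hnonneg hMC hs (isRow_of_mem hM s)) (fun M hM B hBM => ?_)
      (hx.exists_optimal_chain hnonneg hMC)
    obtain ⟨s, hs, h⟩ := hB M hM B hBM
    exact ⟨s, hs, h.imp id fun h => (hx.2.1 s h).le⟩
  · obtain ⟨M, hM, heq⟩ := hy.exists_optimal_chain hnonneg hMC
    refine isGreatest_reachProb hy0 hy.1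
      (fun M hM s hs => hy.sum_le hnonneg hMC hs (isRow_of_mem hM s))
      ⟨M, hM, heq, fun B hBM => ?_⟩
    obtain ⟨s, hs, h⟩ := hB M hM B hBM
    exact ⟨s, hs, h.imp id fun h => (hy.2.1 s h).le⟩

end IMC

/-! ### Solutions for the elimination solve the original problem -/

namespace IMC

variable {S : Type*} [Fintype S] {I : IMC S} {good : Set S}

/-- A solution for the elimination is a fixed point for some original Markov chain whose bottom
components meet the target or the zeros of the solution. -/
theorem exists_chain_of_elim_solvesSystem (hnonneg : ∀ s t, 0 ≤ I.lo s t)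
    (hMC : I.inducedMCs.Nonempty)
    (hgood : ∀ B, I.IsEC B → (∃ s ∈ B, s ∈ good) → ∀ s ∈ B, s ∈ good)
    (hbad : (I.elimMECs good).Nonempty → (I.bad good).Nonempty)
    (hexit : ∀ B ∈ I.elimMECs good, ∀ s ∈ B, ∀ t, t ∉ B →
      ¬ (I.lo s t = 0 ∧ I.hi s t = 0) → ∃ M ∈ I.inducedMCs, 0 < M.prob s t)
    {opt : Opt} {x : I.ElimStates good → ℝ}
    (hx : (I.elim good).SolvesSystem (I.elimGood good) opt x) :
    ∃ M ∈ I.inducedMCs,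
      (∀ s ∉ good, x (I.toElim good s) = ∑ t, M.prob s t * x (I.toElim good t)) ∧
      ∀ W, M.IsBSCC W → ∃ s ∈ W, s ∈ good ∨ x (I.toElim good s) ≤ 0 := by
  classical
  have hnonneg' := elim_lo_nonneg (good := good) hnonneg
  have hMC' := elim_inducedMCs_nonempty hnonneg hMC hbad
  obtain ⟨N, hN, hNx⟩ := hx.exists_optimal_chain hnonneg' hMC'
  obtain ⟨M, hM, β, hβ, hrow, hstay, hbscc⟩ := exists_lift hnonneg hMC hgood hexit hN
  have hx_bad : ∀ b ∈ I.bad good, x (I.toElim good b) = 0 := fun b hb =>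
    hx.2.1 _ ((toElim_mem_bad hnonneg hMC hbad).2 hb)
  -- each single transition out of an eliminated end component competes in the optimum, so those
  -- in the support of an optimal row are optimal themselves
  have hβx : ∀ A : I.ElimStates good, A.1 ∈ I.elimMECs good → x (β A) = x A := by
    intro A hA
    obtain ⟨s, rfl⟩ := exists_toElim_eq A
    have hsg : I.toElim good s ∉ I.elimGood good := fun h =>
      (notMem_of_mem_elimMECs hA (mem_toElim s)).1 (toElim_mem_elimGood.1 h)
    have hdirac : ∀ B, 0 < N.prob (I.toElim good s) B →
        ∑ C, (Pi.single B (1 : ℝ) : I.ElimStates good → ℝ) C * x C = x B ∧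
          (I.elim good).IsRow (I.toElim good s) (Pi.single B 1) := fun B hB =>
      ⟨by simp [Pi.single_apply], isRow_single hA ((isRow_of_mem hN _).elimEdge hA hB)⟩
    have hsum : ∑ B, N.prob (I.toElim good s) B * (x B - x (I.toElim good s)) = 0 := by
      simp_rw [mul_sub, Finset.sum_sub_distrib, ← Finset.sum_mul, N.prob_sum, ← hNx _ hsg]
      ring
    have hzero : N.prob (I.toElim good s) (β (I.toElim good s)) *
        (x (β (I.toElim good s)) - x (I.toElim good s)) = 0 := by
      cases opt with
      | min =>
        refine (Finset.sum_eq_zero_iff_of_nonneg fun B _ => ?_).1 hsum _ (Finset.mem_univ _)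
        rcases (N.prob_nonneg (I.toElim good s) B).eq_or_lt with h | h
        · rw [← h, zero_mul]
        · refine mul_nonneg h.le (sub_nonneg.2 ?_)
          exact (hx.le_sum hnonneg' hMC' hsg (hdirac B h).2).trans (hdirac B h).1.le
      | max =>
        refine (Finset.sum_eq_zero_iff_of_nonpos fun B _ => ?_).1 hsum _ (Finset.mem_univ _)
        rcases (N.prob_nonneg (I.toElim good s) B).eq_or_lt with h | h
        · rw [← h, zero_mul]
        · refine mul_nonpos_of_nonneg_of_nonpos h.le (sub_nonpos.2 ?_)
          exact (hdirac B h).1.ge.trans (hx.sum_le hnonneg' hMC' hsg (hdirac B h).2)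
    exact sub_eq_zero.1 ((mul_eq_zero.1 hzero).resolve_left (hβ _).ne')
  refine ⟨M, hM, fun s hs => ?_, fun W hW => ?_⟩
  · by_cases hsE : (I.toElim good s).1 ∈ I.elimMECs good
    · have hconst : ∀ t, M.prob s t * x (I.toElim good t) =
          M.prob s t * x (I.toElim good s) := by
        intro t
        rcases (M.prob_nonneg s t).eq_or_lt with h | h
        · rw [← h, zero_mul, zero_mul]
        · rcases hstay s hsE t h with h' | h'
          · rw [h']
          · rw [h', hβx _ hsE]
      simp_rw [hconst, ← Finset.sum_mul, M.prob_sum, one_mul]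
    · rw [← sum_elimStates_mul hnonneg, hNx _ fun h => hs (toElim_mem_elimGood.1 h)]
      exact Finset.sum_congr rfl fun B _ => by rw [hrow s hsE]
  · by_contra! h
    obtain ⟨s, hs, hsE, b, hb, hβb⟩ := hbscc W hW fun s hs =>
      ⟨(h s hs).1, fun hb => (h s hs).2.ne' (hx_bad s hb)⟩
    have hpos := (h s hs).2
    rw [← hβx _ hsE, hβb, hx_bad b hb] at hpos
    exact lt_irrefl _ hpos

/-- The solution of the minimizing equations for the elimination is the original minimum: it
vanishes on eliminated end components, in which chains can stay for ever, and every other row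
induces one of the elimination. -/
theorem isLeast_of_elim_solvesSystem (hnonneg : ∀ s t, 0 ≤ I.lo s t)
    (hMC : I.inducedMCs.Nonempty)
    (hgood : ∀ B, I.IsEC B → (∃ s ∈ B, s ∈ good) → ∀ s ∈ B, s ∈ good)
    (hbad : (I.elimMECs good).Nonempty → (I.bad good).Nonempty)
    (hexit : ∀ B ∈ I.elimMECs good, ∀ s ∈ B, ∀ t, t ∉ B →
      ¬ (I.lo s t = 0 ∧ I.hi s t = 0) → ∃ M ∈ I.inducedMCs, 0 < M.prob s t)
    {x : I.ElimStates good → ℝ}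
    (hx : (I.elim good).SolvesSystem (I.elimGood good) .min x) (hx0 : ∀ A, 0 ≤ x A) :
    IsLeast ((fun M => M.reachProb good I.init) '' I.inducedMCs) (x (I.elim good).init) := by
  classical
  have hnonneg' := elim_lo_nonneg (good := good) hnonneg
  have hMC' := elim_inducedMCs_nonempty hnonneg hMC hbad
  have hsg : ∀ s ∉ good, I.toElim good s ∉ I.elimGood good := fun s hs h =>
    hs (toElim_mem_elimGood.1 h)
  have hx_bad : ∀ b ∈ I.bad good, x (I.toElim good b) = 0 := fun b hb =>
    hx.2.1 _ ((toElim_mem_bad hnonneg hMC hbad).2 hb)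
  -- an eliminated end component may move to a bad state
  have hxE : ∀ s, (I.toElim good s).1 ∈ I.elimMECs good → x (I.toElim good s) ≤ 0 := by
    intro s hs
    obtain ⟨b, hb, hedge⟩ := exists_elimEdge hbad hs
    have h := hx.le_sum hnonneg' hMC' (hsg s (notMem_of_mem_elimMECs hs (mem_toElim s)).1)
      (isRow_single hs hedge)
    simpa [Pi.single_apply, hx_bad b hb] using h
  refine isLeast_reachProb (x := fun s => x (I.toElim good s)) (fun s => hx0 _)
    (fun s hs => hx.1 _ (toElim_mem_elimGood.2 hs)) (fun M hM s hs hpos => ?_)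
    (fun M hM W hW => ?_) ?_
  · rw [← sum_elimStates_mul hnonneg]
    exact hx.le_sum hnonneg' hMC' (hsg s hs)
      ((isRow_of_mem hM s).toElim hnonneg fun h => (hxE s h).not_gt hpos)
  · obtain ⟨s, hs⟩ := hW.1
    refine ⟨s, hs, or_iff_not_imp_left.2 fun hsg => ?_⟩
    by_cases hsb : s ∈ I.bad good
    · exact (hx_bad s hsb).le
    · obtain ⟨B, hB, hWB⟩ := IsEC.exists_elimMEC hnonneg hMC hgood ⟨M, hM, hW⟩ hs hsg hsb
      refine hxE s ?_
      rwa [show (I.toElim good s).1 = B from elimState_of_mem hnonneg hB (hWB hs)]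
  · obtain ⟨M, hM, h, -⟩ :=
      exists_chain_of_elim_solvesSystem hnonneg hMC hgood hbad hexit hx
    exact ⟨M, hM, h⟩

/-- The solution of the maximizing equations for the elimination is the original maximum: no exit
from an eliminated end component leads to a larger value than the best one. -/
theorem isGreatest_of_elim_solvesSystem (hnonneg : ∀ s t, 0 ≤ I.lo s t)
    (hMC : I.inducedMCs.Nonempty)
    (hgood : ∀ B, I.IsEC B → (∃ s ∈ B, s ∈ good) → ∀ s ∈ B, s ∈ good)
    (hbad : (I.elimMECs good).Nonempty → (I.bad good).Nonempty)
    (hexit : ∀ B ∈ I.elimMECs good, ∀ s ∈ B, ∀ t, t ∉ B →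
      ¬ (I.lo s t = 0 ∧ I.hi s t = 0) → ∃ M ∈ I.inducedMCs, 0 < M.prob s t)
    {x : I.ElimStates good → ℝ}
    (hx : (I.elim good).SolvesSystem (I.elimGood good) .max x) (hx0 : ∀ A, 0 ≤ x A) :
    IsGreatest ((fun M => M.reachProb good I.init) '' I.inducedMCs) (x (I.elim good).init) := by
  classical
  have hnonneg' := elim_lo_nonneg (good := good) hnonneg
  have hMC' := elim_inducedMCs_nonempty hnonneg hMC hbad
  have hsg : ∀ s ∉ good, I.toElim good s ∉ I.elimGood good := fun s hs h =>
    hs (toElim_mem_elimGood.1 h)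
  refine isGreatest_reachProb (x := fun s => x (I.toElim good s)) (fun s => hx0 _)
    (fun s hs => hx.1 _ (toElim_mem_elimGood.2 hs)) (fun M hM s hs => ?_)
    (exists_chain_of_elim_solvesSystem hnonneg hMC hgood hbad hexit hx)
  by_cases hsE : (I.toElim good s).1 ∈ I.elimMECs good
  · have hle : ∀ t, 0 < M.prob s t → x (I.toElim good t) ≤ x (I.toElim good s) := by
      intro t ht
      by_cases hne : I.toElim good s = I.toElim good t
      · rw [hne]
      · have h := hx.sum_le hnonneg' hMC' (hsg s hs)
          (isRow_single hsE ((canStep_of_mem hM ht).elimEdge hnonneg hne))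
        simpa [Pi.single_apply] using h
    calc ∑ t, M.prob s t * x (I.toElim good t)
        ≤ ∑ t, M.prob s t * x (I.toElim good s) := by
          refine Finset.sum_le_sum fun t _ => ?_
          rcases (M.prob_nonneg s t).eq_or_lt with h | h
          · rw [← h, zero_mul, zero_mul]
          · exact mul_le_mul_of_nonneg_left (hle t h) h.le
      _ = x (I.toElim good s) := by rw [← Finset.sum_mul, M.prob_sum, one_mul]
  · rw [← sum_elimStates_mul hnonneg]
    exact hx.sum_le hnonneg' hMC' (hsg s hs) ((isRow_of_mem hM s).toElim hnonneg hsE)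

end IMC
theorem mainTheorem1 {S : Type*} [Fintype S] (I : IMC S) (good : Set S)
    -- the intervals contain no negative numbers
    (hnonneg : ∀ s t, 0 ≤ I.lo s t)
    -- some Markov chain is induced
    (hMC : I.inducedMCs.Nonempty)
    -- the target states form end components of their own
    (hgood : ∀ B, I.IsEC B → (∃ s ∈ B, s ∈ good) → ∀ s ∈ B, s ∈ good)
    -- there is a bad state, unless nothing is eliminated
    (hbad : (I.elimMECs good).Nonempty → (I.bad good).Nonempty)
    -- transitions that leave an eliminated end component can be taken
    (hexit : ∀ B ∈ I.elimMECs good, ∀ s ∈ B, ∀ t, t ∉ B →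
      ¬ (I.lo s t = 0 ∧ I.hi s t = 0) → ∃ M ∈ I.inducedMCs, 0 < M.prob s t) :
    (∀ opt : Opt, ∃! x : I.ElimStates good → ℝ,
      (I.elim good).SolvesSystem (I.elimGood good) opt x) ∧
    ∃ a b : ℝ, I.IsReachabilityInterval good a b ∧
      (I.elim good).IsReachabilityInterval (I.elimGood good) a b := by
  have hnonneg' := IMC.elim_lo_nonneg (good := good) hnonneg
  have hMC' := IMC.elim_inducedMCs_nonempty hnonneg hMC hbad
  have hB : ∀ N ∈ (I.elim good).inducedMCs, ∀ C, N.IsBSCC C →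
      ∃ A ∈ C, A ∈ I.elimGood good ∨ A ∈ (I.elim good).bad (I.elimGood good) :=
    fun N hN C hC => IMC.elim_isBSCC_meets hnonneg hMC hgood hbad hexit hN hC
  refine ⟨fun opt => ?_, ?_⟩
  · obtain ⟨x, hx, -⟩ := IMC.exists_solvesSystem (good := I.elimGood good) hnonneg' hMC' opt
    exact ⟨x, hx, fun y hy => hy.unique hnonneg' hMC' hB hx⟩
  · obtain ⟨x, hx, hx0⟩ := IMC.exists_solvesSystem (good := I.elimGood good) hnonneg' hMC' .min
    obtain ⟨y, hy, hy0⟩ := IMC.exists_solvesSystem (good := I.elimGood good) hnonneg' hMC' .max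
    exact ⟨x (I.elim good).init, y (I.elim good).init,
      ⟨IMC.isLeast_of_elim_solvesSystem hnonneg hMC hgood hbad hexit hx hx0,
        IMC.isGreatest_of_elim_solvesSystem hnonneg hMC hgood hbad hexit hy hy0⟩,
      IMC.isReachabilityInterval_of_solvesSystem hnonneg' hMC' hB hx hx0 hy hy0⟩
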